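/- Let $\alpha\ge 2$ be an integer and let $1\ge\gamma_1\ge\gamma_2\ge\dots>0$. Let $\varphi_s(x)=\prod_{j=1}^s(2\pi)^{-1/2}e^{-x_j^2/2}$ be the standard normal density on $\mathbb R^s$, and let $H_s$ be the weighted anchored Gaussian Sobolev space of functions $f:\mathbb R^s\to\mathbb R$ (with mixed partial derivatives up to order $\alpha$ in each variable, those of order less than $\alpha$ in a variable being locally absolutely continuous in that variable) with finite norm $$\|f\|_s^2=\sum_{u\subseteq\{1,\dots,s\}}\ \sum_{\tau\in\{0,\dots,\alpha-1\}^{u}}\Big(\prod_{j\notin u}\gamma_j^{-1}\prod_{j\in u,\ \tau_j\ne0}\gamma_j^{-1}\Big)\int_{\mathbb R^{s-|u|}}\Big(\partial^{(\tau_u,\alpha_{-u})}f(x_{-u},0_u)\Big)^2\varphi_{s-|u|}(x_{-u})\,dx_{-u},$$ where $\partial^{(\tau_u,\alpha_{-u})}$ differentiates $\tau_j$ times in $x_j$ for $j\in u$ and $\alpha$ times for $j\notin u$. For $n\ge0$ let $$e(n,s)=\inf_{w_i\in\mathbb R,\ p_i\in\mathbb R^s}\ \sup_{\|f\|_s\le1}\Big|\int_{\mathbb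 R^s} f(x)\varphi_s(x)\,dx-\sum_{i=1}^n w_i f(p_i)\Big|.$$ For $s\ge1$ and $\varepsilon\in(0,1)$ let $n(\varepsilon,s)$ be the least $n\ge 0$ with $e(n,s)\le\varepsilon$ (absolute error criterion) or with $e(n,s)\le\varepsilon\, e(0,s)$ (normalized error criterion). One says that the integration problem satisfies, under the chosen criterion, * SPT (strong polynomial tractability) if there are $\tau,C\ge0$ with $n(\varepsilon,s)\le C\varepsilon^{-\tau}$ for all $s\ge1$, $\varepsilon\in(0,1)$; * PT (polynomial tractability) if there are $\tau,\sigma,C\ge0$ with $n(\varepsilon,s)\le C\varepsilon^{-\tau}s^{\sigma}$ for all $s\ge1$, $\varepsilon\in(0,1)$; * $(\sigma,\tau)$-WT (weak tractability with parameters $\sigma,\tau>0$) if $\ln n(\varepsilon,s)/(s^{\sigma}+\varepsilon^{-\tau})\to0$ as $s+\varepsilon^{-1}\to\infty$; WT (weak tractability) is $(1,1)$-WT; * UWT (uniform weak tractability) if $(\sigma,\tau)$-WT holds for all $\sigma,\tau\in(0,1]$. Then, for each of the two error criteria: 1. SPT holds if and only if $\sum_{j=1}^\infty\gamma_j<\infty$.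 2. PT holds if and only if $\limsup_{s\to\infty}\frac1{\ln s}\sum_{j=1}^s\gamma_j<\infty$. 3. WT holds if and only if $\lim_{s\to\infty}\frac1s\sum_{j=1}^s\gamma_j=0$. 4. For all $\sigma\in(0,1]$ and $\tau>0$, $(\sigma,\tau)$-WT holds if and only if $\lim_{s\to\infty}\frac1{s^\sigma}\sum_{j=1}^s\gamma_j=0$. 5. UWT holds if and only if $\lim_{s\to\infty}\frac1{s^\sigma}\sum_{j=1}^s\gamma_j=0$ for all $\sigma\in(0,1]$. -/

import Mathlib

open Filter Topology MeasureTheory ProbabilityTheory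
open scoped ENNReal

noncomputable section

namespace AnchoredSpace

/-- The standard Gaussian measure on `ℝ ^ s`, with density `∏ j, exp (-x j ^ 2 / 2) / √(2 π)`. -/
def gaussian (s : ℕ) : Measure (Fin s → ℝ) :=
  Measure.pi fun _ => gaussianReal 0 1

/-- `D` is a system of mixed partial derivatives `∂ ^ τ f`, `0 ≤ τ ≤ α` (coordinatewise), of `f`:
`D τ` is locally absolutely continuous in every coordinate `x j` with `τ j < α`, with derivative
`D (τ + e j)` in that coordinate.  For `s = 1` this says that `f` is `α - 1` times
differentiable, that `f ^ (α - 1)` is locally absolutely continuous, and that `D τ = f ^ (τ)`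
(almost everywhere if `τ = α`).  In general `D τ` is the classical partial derivative if `τ < α`
in every coordinate; otherwise `D τ` is the partial derivative in the weak sense, in a version
which has traces on the coordinate planes `x j = c` for the `j` with `τ j < α`. -/
structure IsDerivSystem (α : ℕ) {s : ℕ} (f : (Fin s → ℝ) → ℝ)
    (D : (Fin s → ℕ) → (Fin s → ℝ) → ℝ) : Prop where
  zero : D 0 = f
  measurable : ∀ τ : Fin s → ℕ, (∀ i, τ i ≤ α) → Measurable (D τ)
  intervalIntegrable : ∀ τ : Fin s → ℕ, (∀ i, τ i ≤ α) → ∀ j, τ j < α →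
    ∀ (x : Fin s → ℝ) (a b : ℝ),
      IntervalIntegrable (fun t => D (τ + Pi.single j 1) (Function.update x j t)) volume a b
  sub_eq_integral : ∀ τ : Fin s → ℕ, (∀ i, τ i ≤ α) → ∀ j, τ j < α →
    ∀ (x : Fin s → ℝ) (a b : ℝ),
      D τ (Function.update x j b) - D τ (Function.update x j a) =
        ∫ t in a..b, D (τ + Pi.single j 1) (Function.update x j t)

/-- The squared anchored norm
`∑_{u ⊆ [s]} ∑_{τ_u ∈ {0, …, α - 1} ^ u} γ_{τ_u}⁻¹
  ∫_{ℝ ^ (s - |u|)} (∂ ^ (τ_u, α_{-u}) f (x_{-u}, 0)) ^ 2 φ (x_{-u}) dx_{-u}`.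
A pair `(u, τ_u)` is coded by the multiindex `κ = (τ_u, α_{-u}) ∈ {0, …, α} ^ s`, so that
`u = {j | κ j < α}`, and `γ_{τ_u}` is the product of the `γ j` with `κ j ≠ 0`.  The integrand does
not depend on `x_u`, so integrating over all of `ℝ ^ s` against the Gaussian probability measure
is the same as integrating over `ℝ ^ (s - |u|)`. -/
def normSq (α : ℕ) (γ : ℕ → ℝ) {s : ℕ} (D : (Fin s → ℕ) → (Fin s → ℝ) → ℝ) : ℝ≥0∞ :=
  ∑ κ ∈ Fintype.piFinset fun _ : Fin s => Finset.range (α + 1),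
    ENNReal.ofReal (∏ j : Fin s, if κ j = 0 then 1 else γ j)⁻¹ *
      ∫⁻ x, ENNReal.ofReal (D κ (fun j => if κ j < α then 0 else x j) ^ 2) ∂gaussian s

/-- The closed unit ball of the weighted anchored Gaussian Sobolev space on `ℝ ^ s` with smoothness
`α` and product weights `γ 0, …, γ (s - 1)` (coordinates are numbered from `0`). -/
def unitBall (α : ℕ) (γ : ℕ → ℝ) (s : ℕ) : Set ((Fin s → ℝ) → ℝ) :=
  {f | ∃ D, IsDerivSystem α f D ∧ normSq α γ D ≤ 1}

/-- The worst case error over the unit ball of the linear algorithm `f ↦ ∑ i, w i * f (p i)` for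
Gaussian integration. -/
def worstCaseError (α : ℕ) (γ : ℕ → ℝ) (s : ℕ) {n : ℕ} (w : Fin n → ℝ)
    (p : Fin n → Fin s → ℝ) : ℝ≥0∞ :=
  ⨆ f ∈ unitBall α γ s, ENNReal.ofReal |∫ x, f x ∂gaussian s - ∑ i, w i * f (p i)|

/-- The `n`-th minimal worst case error.  For `n = 0` this is the initial error. -/
def minError (α : ℕ) (γ : ℕ → ℝ) (s n : ℕ) : ℝ≥0∞ :=
  ⨅ (w : Fin n → ℝ) (p : Fin n → Fin s → ℝ), worstCaseError α γ s w p

/-- Errors are measured absolutely, or relative to the initial error. -/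
inductive ErrorCriterion : Type
  | absolute
  | normalized

/-- The factor by which the error threshold is multiplied. -/
def ErrorCriterion.scale (c : ErrorCriterion) (α : ℕ) (γ : ℕ → ℝ) (s : ℕ) : ℝ≥0∞ :=
  match c with
  | .absolute => 1
  | .normalized => minError α γ s 0

/-- The information complexity: the least `n` with minimal error at most `ε` (times the initial
error, for the normalized criterion), and `∞` if there is none. -/
def infoComplexity (c : ErrorCriterion) (α : ℕ) (γ : ℕ → ℝ) (s : ℕ) (ε : ℝ) : ℕ∞ :=
  ⨅ (n : ℕ) (_ : minError α γ s n ≤ ENNReal.ofReal ε * c.scale α γ s), (n : ℕ∞)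

/-- Strong polynomial tractability. -/
def SPT (c : ErrorCriterion) (α : ℕ) (γ : ℕ → ℝ) : Prop :=
  ∃ τ C : ℝ, 0 ≤ τ ∧ 0 ≤ C ∧ ∀ s : ℕ, 1 ≤ s → ∀ ε : ℝ, 0 < ε → ε < 1 →
    (infoComplexity c α γ s ε : ℝ≥0∞) ≤ ENNReal.ofReal (C * ε ^ (-τ))

/-- Polynomial tractability. -/
def PT (c : ErrorCriterion) (α : ℕ) (γ : ℕ → ℝ) : Prop :=
  ∃ τ σ C : ℝ, 0 ≤ τ ∧ 0 ≤ σ ∧ 0 ≤ C ∧ ∀ s : ℕ, 1 ≤ s → ∀ ε : ℝ, 0 < ε → ε < 1 →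
    (infoComplexity c α γ s ε : ℝ≥0∞) ≤ ENNReal.ofReal (C * ε ^ (-τ) * (s : ℝ) ^ σ)

/-- The limit `s + ε⁻¹ → ∞` over the pairs `(s, ε)` with `s ≥ 1` and `0 < ε < 1`. -/
def sizeAtTop : Filter (ℕ × ℝ) :=
  comap (fun q => (q.1 : ℝ) + q.2⁻¹) atTop ⊓ 𝓟 {q | 1 ≤ q.1 ∧ 0 < q.2 ∧ q.2 < 1}

/-- Weak tractability. -/
def WT (c : ErrorCriterion) (α : ℕ) (γ : ℕ → ℝ) : Prop :=
  Tendsto (fun q : ℕ × ℝ => ENNReal.log (infoComplexity c α γ q.1 q.2 : ℝ≥0∞) /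
    (((q.1 : ℝ) + q.2⁻¹ : ℝ) : EReal)) sizeAtTop (𝓝 0)

/-- `(σ, τ)`-weak tractability. -/
def STWT (c : ErrorCriterion) (α : ℕ) (γ : ℕ → ℝ) (σ τ : ℝ) : Prop :=
  Tendsto (fun q : ℕ × ℝ => ENNReal.log (infoComplexity c α γ q.1 q.2 : ℝ≥0∞) /
    (((q.1 : ℝ) ^ σ + q.2 ^ (-τ) : ℝ) : EReal)) sizeAtTop (𝓝 0)

/-- Uniform weak tractability. -/
def UWT (c : ErrorCriterion) (α : ℕ) (γ : ℕ → ℝ) : Prop :=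
  ∀ σ τ : ℝ, 0 < σ → σ ≤ 1 → 0 < τ → τ ≤ 1 → STWT c α γ σ τ

end AnchoredSpace

end

/-!
Taylor's formula at the anchor in every variable, written as an integral against the Gaussian
measure, represents `f` by its anchored derivatives, i.e. by the data which enter the norm.  So the
error of an algorithm is the inner product of these data with an explicit representer.

For nodes which are independent Gaussian points with weights `1 / n`, the mean squared norm of the
representer is at most `(∏ j, (1 + γ j * K)) / n` with `K = kernelSlope α`, and some nodes do as
well as the mean.  Hence `n(ε, s) ≤ 2 ε⁻² exp (K * ∑ j ≤ s, γ j)`.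

For the lower bound split the representer of the integral, coordinatewise, according to the sign of
the variable in the derivatives of order `α`.  A component which contains the negative half-line in
some coordinate `j` vanishes at all `x` with `x j > 0`, and vice versa.  The components which vanish
at all nodes add up to a fooling function.  The components which do not vanish at a given node carry
at most a fraction `exp (-c * ∑ j ≤ s, γ j)` of the squared norm of the representer, so that
`n(ε, s) ≥ (1 - ε²) exp (c * ∑ j ≤ s, γ j)`.

Therefore `ln n(ε, s)` is `∑ j ≤ s, γ j` up to constant factors and a multiple of `ln ε⁻¹`, and each
notion of tractability translates into a growth condition on the partial sums of the weights.
-/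

noncomputable section

namespace AnchoredSpace

/-! ### Taylor expansion in one variable -/

/-- `q 0, …, q α` are the successive derivatives of a function of one variable: for `k < α`, the
function `q k` is locally absolutely continuous with derivative `q (k + 1)`. -/
structure IsDerivChain (α : ℕ) (q : ℕ → ℝ → ℝ) : Prop where
  measurable : ∀ k ≤ α, Measurable (q k)
  intervalIntegrable : ∀ k < α, ∀ a b, IntervalIntegrable (q (k + 1)) volume a b
  sub_eq_integral : ∀ k < α, ∀ a b, q k b - q k a = ∫ t in a..b, q (k + 1) t

theorem integral_mul_eq_of_forall_sub_eq_integral {u v v' : ℝ → ℝ} {a b : ℝ}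
    (hu : ContDiff ℝ 1 u) (hv' : IntervalIntegrable v' volume a b)
    (hv : ∀ x, v x - v a = ∫ t in a..x, v' t) :
    ∫ t in a..b, u t * v' t = u b * v b - u a * v a - ∫ t in a..b, deriv u t * v t := by
  have v_eq : v = fun x => v a + ∫ t in a..x, v' t := by
    ext x; rw [← hv]; ring
  have v_ac : AbsolutelyContinuousOnInterval v a b := by
    rw [v_eq]
    exact (contDiff_const (n := 1)).contDiffOn.absolutelyContinuousOnInterval.fun_add
      (hv'.absolutelyContinuousOnInterval_intervalIntegral Set.left_mem_uIcc)
  rw [← hu.contDiffOn.absolutelyContinuousOnInterval.integral_mul_deriv_eq_deriv_mul v_ac]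
  refine intervalIntegral.integral_congr_ae ?_
  filter_upwards [hv'.ae_hasDerivAt_integral] with t ht hmem
  have deriv_v : deriv v t = v' t := by
    rw [v_eq]
    exact ((ht (Set.uIoc_subset_uIcc hmem) a Set.left_mem_uIcc).const_add (v a)).deriv
  rw [deriv_v]

theorem deriv_sub_pow_div_factorial (x t : ℝ) (m : ℕ) :
    deriv (fun t : ℝ => (x - t) ^ (m + 1) / (m + 1).factorial) t =
      -((x - t) ^ m / m.factorial) := by
  have hasDerivAt := (((hasDerivAt_id t).const_sub x).pow (m + 1)).div_const
    ((m + 1).factorial : ℝ)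
  refine hasDerivAt.deriv.trans ?_
  rw [Nat.factorial_succ]
  push_cast
  simp only [id]
  field_simp

namespace IsDerivChain

variable {α : ℕ} {q : ℕ → ℝ → ℝ}

theorem taylor (hq : IsDerivChain α q) (a x : ℝ) {m : ℕ} (hm : m < α) :
    q 0 x = ∑ k ∈ Finset.range (m + 1), q k a * ((x - a) ^ k / k.factorial) +
      ∫ t in a..x, (x - t) ^ m / m.factorial * q (m + 1) t := by
  induction m with
  | zero => simp [← hq.sub_eq_integral 0 hm a x]
  | succ m ih =>
    have by_parts := integral_mul_eq_of_forall_sub_eq_integral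
      (u := fun t : ℝ => (x - t) ^ (m + 1) / (m + 1).factorial) (by fun_prop)
      (hq.intervalIntegrable (m + 1) hm a x) (hq.sub_eq_integral (m + 1) hm a)
    simp only [deriv_sub_pow_div_factorial, neg_mul, intervalIntegral.integral_neg] at by_parts
    rw [ih (by omega), Finset.sum_range_succ _ (m + 1), by_parts]
    simp
    ring

end IsDerivChain

/-- The kernel of the Taylor expansion at `0` with respect to the standard Gaussian measure:
`x ^ k / k!` for `k < α`, and for `k = α` the kernel of the integral remainder, divided by the
Gaussian density. -/
def taylorKernel (α k : ℕ) (x t : ℝ) : ℝ :=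
  if k < α then x ^ k / k.factorial
  else (if 0 ≤ x then 1 else -1) * (Set.uIoc 0 x).indicator
    (fun t => (x - t) ^ (α - 1) / (α - 1).factorial / gaussianPDFReal 0 1 t) t

/-- The point at which the Taylor expansion evaluates the derivative of order `k`: the anchor `0`
if `k < α`, and the integration variable `t` if `k = α`. -/
def anchor (α k : ℕ) (t : ℝ) : ℝ := if k < α then 0 else t

@[fun_prop]
theorem measurable_anchor (α k : ℕ) : Measurable (anchor α k) := by
  unfold anchor; split_ifs <;> fun_prop

theorem taylorKernel_of_lt {α k : ℕ} (hk : k < α) (x t : ℝ) :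
    taylorKernel α k x t = x ^ k / k.factorial :=
  if_pos hk

theorem taylorKernel_self (α : ℕ) (x t : ℝ) :
    taylorKernel α α x t = (if 0 ≤ x then 1 else -1) * (Set.uIoc 0 x).indicator
      (fun t => (x - t) ^ (α - 1) / (α - 1).factorial / gaussianPDFReal 0 1 t) t :=
  if_neg (lt_irrefl α)

theorem measurable_taylorKernel (α k : ℕ) :
    Measurable fun p : ℝ × ℝ => taylorKernel α k p.1 p.2 := by
  unfold taylorKernel
  split_ifs
  · fun_prop
  · have measurableSet : MeasurableSet {p : ℝ × ℝ | p.2 ∈ Set.uIoc 0 p.1} :=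
      (measurableSet_lt (f := fun p : ℝ × ℝ => min 0 p.1) (by fun_prop) measurable_snd).inter
        (measurableSet_le (g := fun p : ℝ × ℝ => max 0 p.1) measurable_snd (by fun_prop))
    exact (Measurable.ite (measurableSet_le measurable_const measurable_fst) measurable_const
      measurable_const).mul (Measurable.indicator (by fun_prop) measurableSet)

theorem integral_taylorKernel_self_mul (α : ℕ) (x : ℝ) (F : ℝ → ℝ) :
    ∫ t, taylorKernel α α x t * F t ∂gaussianReal 0 1 =
      ∫ t in (0 : ℝ)..x, (x - t) ^ (α - 1) / (α - 1).factorial * F t := by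
  rw [intervalIntegral.intervalIntegral_eq_integral_uIoc, smul_eq_mul,
    ← integral_indicator measurableSet_uIoc, ← integral_const_mul,
    integral_gaussianReal_eq_integral_smul one_ne_zero]
  congr 1 with t
  have pdf_ne_zero := (gaussianPDFReal_pos 0 1 t one_ne_zero).ne'
  by_cases ht : t ∈ Set.uIoc 0 x
  · simp only [taylorKernel_self, Set.indicator_of_mem ht, smul_eq_mul]
    field_simp
  · simp [taylorKernel_self, Set.indicator_of_notMem ht]

theorem IsDerivChain.eq_sum_integral {α : ℕ} {q : ℕ → ℝ → ℝ} (hα : 0 < α)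
    (hq : IsDerivChain α q) (x : ℝ) :
    q 0 x = ∑ k ∈ Finset.range (α + 1),
      ∫ t, taylorKernel α k x t * q k (anchor α k t) ∂gaussianReal 0 1 := by
  obtain ⟨m, rfl⟩ := Nat.exists_eq_add_one.2 hα
  rw [Finset.sum_range_succ, hq.taylor 0 x m.lt_succ_self]
  congr 1
  · refine Finset.sum_congr rfl fun k hk => ?_
    simp [taylorKernel, anchor, Finset.mem_range.1 hk, mul_comm]
  · simp [anchor, integral_taylorKernel_self_mul]

/-! ### The Taylor kernel is square integrable -/

theorem gaussianPDFReal_le_of_sq_le {x t : ℝ} (h : t ^ 2 ≤ x ^ 2) :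
    gaussianPDFReal 0 1 x ≤ gaussianPDFReal 0 1 t := by
  simp only [gaussianPDFReal, sub_zero]
  gcongr

theorem gaussianPDFReal_add_div_gaussianPDFReal (t z : ℝ) :
    gaussianPDFReal 0 1 (t + z) / gaussianPDFReal 0 1 t =
      Real.exp (-(t * z)) * Real.exp (-(1 / 2) * z ^ 2) := by
  simp only [gaussianPDFReal, sub_zero]
  rw [mul_div_mul_left _ _ (by positivity), ← Real.exp_sub, ← Real.exp_add]
  congr 1
  simp only [NNReal.coe_one]
  ring

theorem norm_taylorKernel_self_le (α : ℕ) (x t : ℝ) :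
    ‖taylorKernel α α x t‖ ≤ |x| ^ (α - 1) / gaussianPDFReal 0 1 x := by
  have pdf_pos := gaussianPDFReal_pos 0 1 x one_ne_zero
  have sign_eq : ‖(if 0 ≤ x then 1 else -1 : ℝ)‖ = 1 := by split_ifs <;> simp
  rw [taylorKernel_self, norm_mul, sign_eq, one_mul]
  by_cases ht : t ∈ Set.uIoc 0 x
  · have sub_le : |x - t| ≤ |x| := by
      simpa using Set.abs_sub_right_of_mem_uIcc (Set.uIoc_subset_uIcc ht)
    have abs_le : |t| ≤ |x| := by
      simpa using Set.abs_sub_left_of_mem_uIcc (Set.uIoc_subset_uIcc ht)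
    have factorial_ge : (1 : ℝ) ≤ (α - 1).factorial := by
      exact_mod_cast (α - 1).factorial_pos
    rw [Set.indicator_of_mem ht, norm_div, norm_div, norm_pow, Real.norm_natCast,
      Real.norm_of_nonneg (gaussianPDFReal_nonneg 0 1 t), Real.norm_eq_abs]
    exact div_le_div₀ (by positivity) ((div_le_self (by positivity) factorial_ge).trans
      (by gcongr)) pdf_pos (gaussianPDFReal_le_of_sq_le (sq_le_sq.2 abs_le))
  · rw [Set.indicator_of_notMem ht, norm_zero]
    positivity

theorem memLp_taylorKernel {α k : ℕ} (hk : k ≤ α) (x : ℝ) (p : ℝ≥0∞) :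
    MemLp (taylorKernel α k x) p (gaussianReal 0 1) := by
  have measurable := (measurable_taylorKernel α k).comp (measurable_prodMk_left (x := x))
  rcases hk.lt_or_eq with hk | rfl
  · exact MemLp.of_bound measurable.aestronglyMeasurable ‖x ^ k / k.factorial‖
      (ae_of_all _ fun t => by rw [taylorKernel_of_lt hk])
  · exact MemLp.of_bound measurable.aestronglyMeasurable _
      (ae_of_all _ fun t => norm_taylorKernel_self_le k x t)

theorem sq_mul_exp_neg_le {t z : ℝ} (h : 0 ≤ t * z) :
    z ^ 2 * Real.exp (-(t * z)) ≤ (1 + t ^ 2)⁻¹ * (2 * (1 + z ^ 2)) := by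
  have exp_le : Real.exp (-(t * z)) ≤ (1 + (t * z) ^ 2 / 2)⁻¹ := by
    rw [Real.exp_neg]
    gcongr
    linarith [Real.quadratic_le_exp_of_nonneg h]
  refine (mul_le_mul_of_nonneg_left exp_le (sq_nonneg z)).trans ?_
  rw [← div_eq_mul_inv, inv_mul_eq_div, div_le_div_iff₀ (by positivity) (by positivity)]
  nlinarith [sq_nonneg z, sq_nonneg (z ^ 2 * t)]

theorem mul_sub_nonneg_of_mem_uIoc {x t : ℝ} (ht : t ∈ Set.uIoc 0 x) : 0 ≤ t * (x - t) := by
  rcases Set.mem_uIoc.1 ht with ⟨_, _⟩ | ⟨_, _⟩ <;> nlinarith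

/-- The factor `exp (-t (x - t))` of the ratio of the densities at `x` and at `t` supplies the decay
in `t`, at the price of the factor `(x - t) ^ 2`, which is why `α = 1` is excluded. -/
theorem gaussianPDFReal_mul_taylorKernel_self_sq_le (m : ℕ) (x t : ℝ) :
    gaussianPDFReal 0 1 x * gaussianPDFReal 0 1 t * taylorKernel (m + 2) (m + 2) x t ^ 2 ≤
      (1 + t ^ 2)⁻¹ * (2 * (1 + (x - t) ^ 2) *
        (((x - t) ^ m) ^ 2 * Real.exp (-(1 / 2) * (x - t) ^ 2))) := by
  rw [taylorKernel_self, mul_pow, show (if 0 ≤ x then 1 else -1 : ℝ) ^ 2 = 1 by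
    split_ifs <;> norm_num, one_mul]
  by_cases ht : t ∈ Set.uIoc 0 x
  · have pdf_ne_zero := (gaussianPDFReal_pos 0 1 t one_ne_zero).ne'
    have ratio := gaussianPDFReal_add_div_gaussianPDFReal t (x - t)
    rw [add_sub_cancel] at ratio
    have factorial_ge : (1 : ℝ) ≤ ((m + 1).factorial : ℝ) ^ 2 :=
      one_le_pow₀ (by exact_mod_cast (m + 1).factorial_pos)
    rw [Set.indicator_of_mem ht]
    calc gaussianPDFReal 0 1 x * gaussianPDFReal 0 1 t *
          ((x - t) ^ (m + 1) / (m + 1).factorial / gaussianPDFReal 0 1 t) ^ 2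
        = gaussianPDFReal 0 1 x / gaussianPDFReal 0 1 t * ((x - t) ^ (m + 1)) ^ 2 /
            ((m + 1).factorial : ℝ) ^ 2 := by field_simp
      _ ≤ gaussianPDFReal 0 1 x / gaussianPDFReal 0 1 t * ((x - t) ^ (m + 1)) ^ 2 :=
          div_le_self (by rw [ratio]; positivity) factorial_ge
      _ = (x - t) ^ 2 * Real.exp (-(t * (x - t))) *
            (((x - t) ^ m) ^ 2 * Real.exp (-(1 / 2) * (x - t) ^ 2)) := by rw [ratio]; ring
      _ ≤ (1 + t ^ 2)⁻¹ * (2 * (1 + (x - t) ^ 2)) *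
            (((x - t) ^ m) ^ 2 * Real.exp (-(1 / 2) * (x - t) ^ 2)) := by
          gcongr ?_ * _
          exact sq_mul_exp_neg_le (mul_sub_nonneg_of_mem_uIoc ht)
      _ = _ := mul_assoc _ _ _
  · rw [Set.indicator_of_notMem ht]
    simp only [ne_eq, OfNat.ofNat_ne_zero, not_false_eq_true, zero_pow, mul_zero]
    positivity

theorem integrable_pow_mul_exp_neg_mul_sq {b : ℝ} (hb : 0 < b) (n : ℕ) :
    Integrable fun z : ℝ => z ^ n * Real.exp (-b * z ^ 2) := by
  simpa only [Real.rpow_natCast] using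
    integrable_rpow_mul_exp_neg_mul_sq hb (neg_one_lt_zero.trans_le n.cast_nonneg)

theorem integrable_prod_gaussianReal_iff {f : ℝ × ℝ → ℝ} :
    Integrable f ((gaussianReal 0 1).prod (gaussianReal 0 1)) ↔
      Integrable fun p => gaussianPDFReal 0 1 p.1 * gaussianPDFReal 0 1 p.2 * f p := by
  have measurable_pdf := measurable_gaussianPDF 0 1
  rw [gaussianReal_of_var_ne_zero 0 one_ne_zero, prod_withDensity measurable_pdf measurable_pdf,
    integrable_withDensity_iff_integrable_smul'
      (f := fun p : ℝ × ℝ => gaussianPDF 0 1 p.1 * gaussianPDF 0 1 p.2) (by fun_prop)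
      (ae_of_all _ fun p => ENNReal.mul_lt_top ENNReal.ofReal_lt_top ENNReal.ofReal_lt_top)]
  simp only [ENNReal.toReal_mul, toReal_gaussianPDF, smul_eq_mul, Measure.volume_eq_prod]

theorem integrable_taylorKernel_sq {α k : ℕ} (hα : 1 < α) (hk : k ≤ α) :
    Integrable (fun p : ℝ × ℝ => taylorKernel α k p.1 p.2 ^ 2)
      ((gaussianReal 0 1).prod (gaussianReal 0 1)) := by
  rcases hk.lt_or_eq with hk | rfl
  · have memLp_id : MemLp (id : ℝ → ℝ) (k * 2 : ℕ) (gaussianReal 0 1) := by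
      simpa using memLp_id_gaussianReal (μ := 0) (v := 1) (k * 2 : ℕ)
    have integrable_pow : Integrable (fun x : ℝ => (x ^ k / k.factorial) ^ 2)
        (gaussianReal 0 1) := by
      simpa [div_pow, pow_mul, pow_right_comm _ k 2] using
        memLp_id.integrable_norm_pow'.div_const ((k.factorial : ℝ) ^ 2)
    simpa only [taylorKernel_of_lt hk] using integrable_pow.comp_fst (gaussianReal 0 1)
  · obtain ⟨m, rfl⟩ := Nat.exists_eq_add_of_le' (Nat.succ_le_of_lt hα)
    have integrable_factor : Integrable fun z : ℝ =>
        2 * (1 + z ^ 2) * ((z ^ m) ^ 2 * Real.exp (-(1 / 2) * z ^ 2)) := by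
      refine (((integrable_pow_mul_exp_neg_mul_sq one_half_pos (m * 2)).add
        (integrable_pow_mul_exp_neg_mul_sq one_half_pos (m * 2 + 2))).const_mul 2).congr
        (ae_of_all _ fun z => ?_)
      simp only [Pi.add_apply]
      ring
    have integrable_bound := Integrable.convolution_integrand (ContinuousLinearMap.mul ℝ ℝ)
      integrable_inv_one_add_sq integrable_factor
    rw [integrable_prod_gaussianReal_iff]
    refine integrable_bound.mono' ?_ (ae_of_all _ fun p => ?_)
    · have := measurable_taylorKernel (m + 2) (m + 2)
      exact Measurable.aestronglyMeasurable (by fun_prop)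
    · have pdf_nonneg := gaussianPDFReal_nonneg 0 1
      rw [Real.norm_of_nonneg
        (mul_nonneg (mul_nonneg (pdf_nonneg _) (pdf_nonneg _)) (sq_nonneg _))]
      exact gaussianPDFReal_mul_taylorKernel_self_sq_le m p.1 p.2

/-! ### Square integrable kernels -/

section SquareIntegrable

variable {X T ι : Type*} [MeasurableSpace X] [MeasurableSpace T] {μ : Measure X} {ν : Measure T}

theorem sq_integral_mul_le {f g : T → ℝ} (hf : MemLp f 2 ν) (hg : MemLp g 2 ν) :
    (∫ t, f t * g t ∂ν) ^ 2 ≤ (∫ t, f t ^ 2 ∂ν) * ∫ t, g t ^ 2 ∂ν := by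
  have quadratic_nonneg : ∀ x : ℝ, 0 ≤ (∫ t, f t ^ 2 ∂ν) * (x * x) +
      2 * (∫ t, f t * g t ∂ν) * x + ∫ t, g t ^ 2 ∂ν := fun x => calc
    0 ≤ ∫ t, (f t * x + g t) ^ 2 ∂ν := integral_nonneg fun t => sq_nonneg _
    _ = ∫ t, f t ^ 2 * (x * x) + f t * g t * (2 * x) + g t ^ 2 ∂ν := by
        congr 1 with t; ring
    _ = _ := by
        have integrable_mul : Integrable (fun t => f t * g t) ν := hf.integrable_mul hg
        rw [integral_add ((hf.integrable_sq.mul_const _).fun_add (integrable_mul.mul_const _))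
          hg.integrable_sq, integral_add (hf.integrable_sq.mul_const _)
          (integrable_mul.mul_const _), integral_mul_const, integral_mul_const]
        ring
  have := discrim_le_zero quadratic_nonneg
  simp only [discrim] at this
  linarith

theorem sq_sum_integral_mul_le (K : Finset ι) {c : ι → ℝ} (hc : ∀ κ ∈ K, 0 < c κ)
    {E G : ι → T → ℝ} (hE : ∀ κ ∈ K, MemLp (E κ) 2 ν) (hG : ∀ κ ∈ K, MemLp (G κ) 2 ν) :
    (∑ κ ∈ K, ∫ t, E κ t * G κ t ∂ν) ^ 2 ≤
      (∑ κ ∈ K, c κ * ∫ t, E κ t ^ 2 ∂ν) * ∑ κ ∈ K, (c κ)⁻¹ * ∫ t, G κ t ^ 2 ∂ν := by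
  refine Finset.sum_sq_le_sum_mul_sum_of_sq_le_mul K
    (fun κ hκ => mul_nonneg (hc κ hκ).le (integral_nonneg fun t => sq_nonneg _))
    (fun κ hκ => mul_nonneg (inv_nonneg.2 (hc κ hκ).le) (integral_nonneg fun t => sq_nonneg _))
    fun κ hκ => ?_
  rw [mul_mul_mul_comm, mul_inv_cancel₀ (hc κ hκ).ne', one_mul]
  exact sq_integral_mul_le (hE κ hκ) (hG κ hκ)

theorem ae_memLp_two_prodMk_right [SFinite μ] [SFinite ν] {F : X × T → ℝ}
    (hF : MemLp F 2 (μ.prod ν)) : ∀ᵐ t ∂ν, MemLp (fun x => F (x, t)) 2 μ := by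
  filter_upwards [hF.1.prodMk_right, hF.integrable_sq.prod_left_ae] with t ht ht_sq
  exact (memLp_two_iff_integrable_sq ht).2 ht_sq

theorem ae_memLp_two_prodMk_left [SFinite μ] [SFinite ν] {F : X × T → ℝ}
    (hF : MemLp F 2 (μ.prod ν)) : ∀ᵐ x ∂μ, MemLp (fun t => F (x, t)) 2 ν := by
  filter_upwards [hF.1.prodMk_left, hF.integrable_sq.prod_right_ae] with x hx hx_sq
  exact (memLp_two_iff_integrable_sq hx).2 hx_sq

variable [IsProbabilityMeasure μ]

theorem sq_integral_le_integral_sq {g : X → ℝ} (hg : MemLp g 2 μ) :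
    (∫ x, g x ∂μ) ^ 2 ≤ ∫ x, g x ^ 2 ∂μ := by
  simpa using sq_integral_mul_le hg (memLp_const (1 : ℝ))

theorem integral_add_sub_integral_sq {g : X → ℝ} (hg : MemLp g 2 μ) (a : ℝ) :
    ∫ x, (a + (g x - ∫ y, g y ∂μ)) ^ 2 ∂μ = a ^ 2 + Var[g; μ] := by
  have memLp_sub : MemLp (fun x => g x - ∫ y, g y ∂μ) 2 μ := hg.sub (memLp_const _)
  have memLp_add : MemLp (fun x => a + (g x - ∫ y, g y ∂μ)) 2 μ := (memLp_const a).add memLp_sub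
  have mean_eq : ∫ x, a + (g x - ∫ y, g y ∂μ) ∂μ = a := by
    rw [integral_add (integrable_const a) (memLp_sub.integrable one_le_two),
      integral_sub (hg.integrable one_le_two) (integrable_const _)]
    simp
  have variance_eq := variance_eq_sub memLp_add
  rw [variance_const_add memLp_sub.1, variance_sub_const hg.1, mean_eq] at variance_eq
  simp only [Pi.pow_apply] at variance_eq
  linarith

variable [SFinite ν]

theorem memLp_two_integral_left {K : X → T → ℝ}
    (hK : MemLp (fun q : X × T => K q.1 q.2) 2 (μ.prod ν)) :
    MemLp (fun t => ∫ x, K x t ∂μ) 2 ν := by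
  have aestronglyMeasurable := hK.1.prod_swap.integral_prod_right'
  refine (memLp_two_iff_integrable_sq aestronglyMeasurable).2
    (hK.integrable_sq.integral_prod_right.mono' (aestronglyMeasurable.pow 2) ?_)
  filter_upwards [ae_memLp_two_prodMk_right hK] with t ht
  rw [Real.norm_of_nonneg (sq_nonneg _)]
  exact sq_integral_le_integral_sq ht

theorem integral_integral_add_sub_integral_sq_le {K : X → T → ℝ} {S : T → ℝ}
    (hK : MemLp (fun q : X × T => K q.1 q.2) 2 (μ.prod ν)) (hS : MemLp S 2 ν)
    (hKS : Integrable (fun q : X × T => (S q.2 + (K q.1 q.2 - ∫ x, K x q.2 ∂μ)) ^ 2)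
      (μ.prod ν)) :
    ∫ y, ∫ t, (S t + (K y t - ∫ x, K x t ∂μ)) ^ 2 ∂ν ∂μ ≤
      ∫ t, S t ^ 2 ∂ν + ∫ x, ∫ t, K x t ^ 2 ∂ν ∂μ := by
  rw [integral_integral_swap hKS,
    integral_integral_swap (f := fun x t => K x t ^ 2) hK.integrable_sq,
    ← integral_add hS.integrable_sq hK.integrable_sq.integral_prod_right]
  refine integral_mono_ae hKS.integral_prod_right
    (hS.integrable_sq.add hK.integrable_sq.integral_prod_right) ?_
  filter_upwards [ae_memLp_two_prodMk_right hK] with t ht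
  rw [integral_add_sub_integral_sq ht]
  exact add_le_add_right (variance_le_expectation_sq ht.1) _

theorem exists_sum_integral_add_sub_integral_sq_le (I : Finset ι) {c : ι → ℝ}
    (hc : ∀ κ ∈ I, 0 ≤ c κ) {K : ι → X → T → ℝ}
    (hK : ∀ κ ∈ I, MemLp (fun q : X × T => K κ q.1 q.2) 2 (μ.prod ν)) {S : ι → T → ℝ}
    (hS : ∀ κ ∈ I, MemLp (S κ) 2 ν) :
    ∃ y, ∑ κ ∈ I, c κ * ∫ t, (S κ t + (K κ y t - ∫ x, K κ x t ∂μ)) ^ 2 ∂ν ≤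
      ∑ κ ∈ I, c κ * ∫ t, S κ t ^ 2 ∂ν +
        ∑ κ ∈ I, c κ * ∫ x, ∫ t, K κ x t ^ 2 ∂ν ∂μ := by
  have integrable_sq : ∀ κ ∈ I, Integrable
      (fun q : X × T => (S κ q.2 + (K κ q.1 q.2 - ∫ x, K κ x q.2 ∂μ)) ^ 2) (μ.prod ν) :=
    fun κ hκ => (((hS κ hκ).comp_snd μ).add
      ((hK κ hκ).sub ((memLp_two_integral_left (hK κ hκ)).comp_snd μ))).integrable_sq
  have integrable_term := fun κ hκ => (integrable_sq κ hκ).integral_prod_left.const_mul (c κ)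
  obtain ⟨y, hy⟩ := exists_le_integral (integrable_finsetSum I integrable_term)
  refine ⟨y, hy.trans ?_⟩
  rw [integral_finsetSum I integrable_term, ← Finset.sum_add_distrib]
  refine Finset.sum_le_sum fun κ hκ => ?_
  rw [integral_const_mul, ← mul_add]
  exact mul_le_mul_of_nonneg_left
    (integral_integral_add_sub_integral_sq_le (hK κ hκ) (hS κ hκ) (integrable_sq κ hκ)) (hc κ hκ)

/-- The right-hand side bounds the expectation of the left-hand side for independent random points;
choosing the points one by one derandomizes this. -/
theorem exists_sum_integral_sum_sub_integral_sq_le (I : Finset ι) {c : ι → ℝ}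
    (hc : ∀ κ ∈ I, 0 ≤ c κ) {K : ι → X → T → ℝ}
    (hK : ∀ κ ∈ I, MemLp (fun q : X × T => K κ q.1 q.2) 2 (μ.prod ν))
    (hK_right : ∀ κ ∈ I, ∀ x, MemLp (K κ x) 2 ν) (n : ℕ) :
    ∃ p : Fin n → X,
      ∑ κ ∈ I, c κ * ∫ t, (∑ i, (K κ (p i) t - ∫ x, K κ x t ∂μ)) ^ 2 ∂ν ≤
        n * ∑ κ ∈ I, c κ * ∫ x, ∫ t, K κ x t ^ 2 ∂ν ∂μ := by
  induction n with
  | zero => exact ⟨Fin.elim0, by simp⟩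
  | succ n ih =>
    obtain ⟨p, hp⟩ := ih
    obtain ⟨y, hy⟩ := exists_sum_integral_add_sub_integral_sq_le I hc hK
      (S := fun κ t => ∑ i, (K κ (p i) t - ∫ x, K κ x t ∂μ)) fun κ hκ =>
        memLp_finsetSum _ fun i _ =>
          (hK_right κ hκ (p i)).sub (memLp_two_integral_left (hK κ hκ))
    refine ⟨Fin.snoc p y, ?_⟩
    simp only [Fin.sum_univ_castSucc, Fin.snoc_castSucc, Fin.snoc_last]
    push_cast
    linarith

end SquareIntegrable

/-! ### Expansion of a function in its anchored derivatives -/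

section Cons

variable {α s : ℕ}

instance : IsProbabilityMeasure (gaussian s) := by
  unfold gaussian; infer_instance

/-- The multi-indices `{0, …, α} ^ s`, which index the terms of `normSq`. -/
abbrev multiIndices (α s : ℕ) : Finset (Fin s → ℕ) :=
  Fintype.piFinset fun _ : Fin s => Finset.range (α + 1)

theorem mem_multiIndices {κ : Fin s → ℕ} : κ ∈ multiIndices α s ↔ ∀ j, κ j ≤ α := by
  simp only [Fintype.mem_piFinset, Finset.mem_range, Nat.lt_succ_iff]

theorem cons_mem_multiIndices {k : ℕ} {κ : Fin s → ℕ} :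
    (Fin.cons k κ : Fin (s + 1) → ℕ) ∈ multiIndices α (s + 1) ↔
      k ∈ Finset.range (α + 1) ∧ κ ∈ multiIndices α s :=
  Fin.mem_piFinset_iff_zero_tail

theorem sum_multiIndices_succ (F : (Fin (s + 1) → ℕ) → ℝ) :
    ∑ κ ∈ multiIndices α (s + 1), F κ =
      ∑ k ∈ Finset.range (α + 1), ∑ κ ∈ multiIndices α s, F (Fin.cons k κ) := by
  rw [← Finset.sum_product']
  exact (Finset.sum_equiv (Fin.consEquiv fun _ => ℕ)
    (fun _ => Finset.mem_product.trans cons_mem_multiIndices.symm) fun _ _ => rfl).symm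

theorem sum_multiIndices_prod (F : Fin s → ℕ → ℝ) :
    ∑ κ ∈ multiIndices α s, ∏ j, F j (κ j) = ∏ j, ∑ k ∈ Finset.range (α + 1), F j k :=
  (Finset.prod_univ_sum _ _).symm

theorem coe_piFinSuccAbove_zero_symm (s : ℕ) :
    ⇑(MeasurableEquiv.piFinSuccAbove (fun _ : Fin (s + 1) => ℝ) 0).symm =
      fun q : ℝ × (Fin s → ℝ) => Fin.cons q.1 q.2 := by
  ext q j
  simp [MeasurableEquiv.piFinSuccAbove_symm_apply, Fin.insertNthEquiv]

theorem measurePreserving_cons (s : ℕ) :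
    MeasurePreserving (fun q : ℝ × (Fin s → ℝ) => (Fin.cons q.1 q.2 : Fin (s + 1) → ℝ))
      ((gaussianReal 0 1).prod (gaussian s)) (gaussian (s + 1)) := by
  rw [← coe_piFinSuccAbove_zero_symm]
  exact (measurePreserving_piFinSuccAbove (fun _ : Fin (s + 1) => gaussianReal 0 1) 0).symm

theorem measurableEmbedding_cons (s : ℕ) :
    MeasurableEmbedding fun q : ℝ × (Fin s → ℝ) => (Fin.cons q.1 q.2 : Fin (s + 1) → ℝ) := by
  rw [← coe_piFinSuccAbove_zero_symm]
  exact MeasurableEquiv.measurableEmbedding _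

theorem integrable_comp_cons {F : (Fin (s + 1) → ℝ) → ℝ} (hF : Integrable F (gaussian (s + 1))) :
    Integrable (fun q : ℝ × (Fin s → ℝ) => F (Fin.cons q.1 q.2))
      ((gaussianReal 0 1).prod (gaussian s)) :=
  (measurePreserving_cons s).integrable_comp_of_integrable hF

theorem integral_gaussian_succ {F : (Fin (s + 1) → ℝ) → ℝ}
    (hF : Integrable F (gaussian (s + 1))) :
    ∫ x, F x ∂gaussian (s + 1) = ∫ t, ∫ y, F (Fin.cons t y) ∂gaussian s ∂gaussianReal 0 1 := by
  rw [← (measurePreserving_cons s).integral_comp (measurableEmbedding_cons s),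
    integral_prod _ (integrable_comp_cons hF)]

theorem cons_add_single_zero (k : ℕ) (τ : Fin s → ℕ) :
    (Fin.cons k τ : Fin (s + 1) → ℕ) + Pi.single 0 1 = Fin.cons (k + 1) τ := by
  ext j
  cases j using Fin.cases <;> simp

theorem cons_add_single_succ (k : ℕ) (τ : Fin s → ℕ) (j : Fin s) :
    (Fin.cons k τ : Fin (s + 1) → ℕ) + Pi.single j.succ 1 = Fin.cons k (τ + Pi.single j 1) := by
  ext i
  cases i using Fin.cases <;> simp [Pi.single_apply]

theorem cons_zero_zero : (Fin.cons 0 0 : Fin (s + 1) → ℕ) = 0 :=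
  Fin.cons_self_tail 0

theorem cons_le {k : ℕ} {τ : Fin s → ℕ} (hk : k ≤ α) (hτ : ∀ i, τ i ≤ α) (i : Fin (s + 1)) :
    (Fin.cons k τ : Fin (s + 1) → ℕ) i ≤ α := by
  cases i using Fin.cases <;> simp [hk, hτ]

namespace IsDerivSystem

variable {f : (Fin (s + 1) → ℝ) → ℝ} {D : (Fin (s + 1) → ℕ) → (Fin (s + 1) → ℝ) → ℝ}

theorem slice (hD : IsDerivSystem α f D) {k : ℕ} (hk : k ≤ α) (c : ℝ) :
    IsDerivSystem α (fun y : Fin s → ℝ => D (Fin.cons k 0) (Fin.cons c y))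
      (fun τ y => D (Fin.cons k τ) (Fin.cons c y)) where
  zero := rfl
  measurable τ hτ := (hD.measurable _ (cons_le hk hτ)).comp
    ((measurableEmbedding_cons s).measurable.comp measurable_prodMk_left)
  intervalIntegrable τ hτ j hj y a b := by
    have := hD.intervalIntegrable (Fin.cons k τ) (cons_le hk hτ) j.succ (by simpa using hj)
      (Fin.cons c y) a b
    simpa only [cons_add_single_succ, Fin.cons_update] using this
  sub_eq_integral τ hτ j hj y a b := by
    have := hD.sub_eq_integral (Fin.cons k τ) (cons_le hk hτ) j.succ (by simpa using hj)
      (Fin.cons c y) a b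
    simpa only [cons_add_single_succ, Fin.cons_update] using this

theorem isDerivChain (hD : IsDerivSystem α f D) (y : Fin s → ℝ) :
    IsDerivChain α fun k t => D (Fin.cons k 0) (Fin.cons t y) where
  measurable k hk := (hD.measurable _ (cons_le hk fun _ => Nat.zero_le _)).comp
    ((measurableEmbedding_cons s).measurable.comp measurable_prodMk_right)
  intervalIntegrable k hk a b := by
    have := hD.intervalIntegrable (Fin.cons k 0) (cons_le hk.le fun _ => Nat.zero_le _) 0
      (by simpa using hk) (Fin.cons 0 y) a b
    simpa only [cons_add_single_zero, Fin.update_cons_zero] using this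
  sub_eq_integral k hk a b := by
    have := hD.sub_eq_integral (Fin.cons k 0) (cons_le hk.le fun _ => Nat.zero_le _) 0
      (by simpa using hk) (Fin.cons 0 y) a b
    simpa only [cons_add_single_zero, Fin.update_cons_zero] using this

end IsDerivSystem

end Cons

/-- The tensor product of the Taylor kernels. -/
def tensorKernel {s : ℕ} (α : ℕ) (κ : Fin s → ℕ) (x t : Fin s → ℝ) : ℝ :=
  ∏ j, taylorKernel α (κ j) (x j) (t j)

/-- The projection onto the plane in `ℝ ^ s` on which `normSq` evaluates the derivative of
order `κ`. -/
def anchors {s : ℕ} (α : ℕ) (κ : Fin s → ℕ) (x : Fin s → ℝ) : Fin s → ℝ :=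
  fun j => anchor α (κ j) (x j)

/-- The mean of the Taylor kernel over its first argument. -/
def meanKernel (α k : ℕ) (t : ℝ) : ℝ := ∫ x, taylorKernel α k x t ∂gaussianReal 0 1

/-- The tensor product of the means of the Taylor kernels, which represents Gaussian integration in
terms of the anchored derivatives of the integrand. -/
def tensorMeanKernel {s : ℕ} (α : ℕ) (κ : Fin s → ℕ) (t : Fin s → ℝ) : ℝ :=
  ∏ j, meanKernel α (κ j) (t j)

section Tensor

variable {α s : ℕ}

theorem measurable_anchors (κ : Fin s → ℕ) : Measurable (anchors α κ) :=
  measurable_pi_lambda _ fun j => (measurable_anchor α (κ j)).comp (measurable_pi_apply j)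

theorem anchors_cons (k : ℕ) (κ : Fin s → ℕ) (t : ℝ) (y : Fin s → ℝ) :
    anchors α (Fin.cons k κ : Fin (s + 1) → ℕ) (Fin.cons t y) =
      Fin.cons (anchor α k t) (anchors α κ y) := by
  ext j
  cases j using Fin.cases <;> simp [anchors]

theorem tensorKernel_cons (k : ℕ) (κ : Fin s → ℕ) (x t : ℝ) (y z : Fin s → ℝ) :
    tensorKernel α (Fin.cons k κ : Fin (s + 1) → ℕ) (Fin.cons x y) (Fin.cons t z) =
      taylorKernel α k x t * tensorKernel α κ y z := by
  simp [tensorKernel, Fin.prod_univ_succ]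

theorem measurable_tensorKernel (κ : Fin s → ℕ) :
    Measurable fun q : (Fin s → ℝ) × (Fin s → ℝ) => tensorKernel α κ q.1 q.2 := by
  have := fun k => measurable_taylorKernel α k
  unfold tensorKernel
  fun_prop

theorem memLp_two_fintype_prod {f : Fin s → ℝ → ℝ} (hf : ∀ j, MemLp (f j) 2 (gaussianReal 0 1)) :
    MemLp (fun t : Fin s → ℝ => ∏ j, f j (t j)) 2 (gaussian s) := by
  have aestronglyMeasurable : AEStronglyMeasurable (fun t : Fin s → ℝ => ∏ j, f j (t j))
      (gaussian s) := (Integrable.fintype_prod fun j => (hf j).integrable one_le_two).1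
  refine (memLp_two_iff_integrable_sq aestronglyMeasurable).2 ?_
  simp only [← Finset.prod_pow]
  exact Integrable.fintype_prod fun j => (hf j).integrable_sq

theorem memLp_tensorKernel_right {κ : Fin s → ℕ} (hκ : κ ∈ multiIndices α s) (x : Fin s → ℝ) :
    MemLp (tensorKernel α κ x) 2 (gaussian s) :=
  memLp_two_fintype_prod fun j => memLp_taylorKernel (mem_multiIndices.1 hκ j) (x j) 2

theorem integral_tensorKernel_sq_right (κ : Fin s → ℕ) (x : Fin s → ℝ) :
    ∫ t, tensorKernel α κ x t ^ 2 ∂gaussian s =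
      ∏ j, ∫ t, taylorKernel α (κ j) (x j) t ^ 2 ∂gaussianReal 0 1 := by
  simp only [tensorKernel, ← Finset.prod_pow]
  exact integral_fintype_prod_eq_prod fun j t => taylorKernel α (κ j) (x j) t ^ 2

theorem integral_integral_tensorKernel_sq (κ : Fin s → ℕ) :
    ∫ x, ∫ t, tensorKernel α κ x t ^ 2 ∂gaussian s ∂gaussian s =
      ∏ j, ∫ x, ∫ t, taylorKernel α (κ j) x t ^ 2 ∂gaussianReal 0 1 ∂gaussianReal 0 1 := by
  simp only [integral_tensorKernel_sq_right]
  exact integral_fintype_prod_eq_prod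
    fun j x => ∫ t, taylorKernel α (κ j) x t ^ 2 ∂gaussianReal 0 1

theorem integral_tensorKernel_left (κ : Fin s → ℕ) (t : Fin s → ℝ) :
    ∫ x, tensorKernel α κ x t ∂gaussian s = tensorMeanKernel α κ t :=
  integral_fintype_prod_eq_prod fun j x => taylorKernel α (κ j) x (t j)

theorem memLp_tensorKernel (hα : 1 < α) {κ : Fin s → ℕ} (hκ : κ ∈ multiIndices α s) :
    MemLp (fun q : (Fin s → ℝ) × (Fin s → ℝ) => tensorKernel α κ q.1 q.2) 2
      ((gaussian s).prod (gaussian s)) := by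
  have measurable := measurable_tensorKernel (α := α) κ
  refine (memLp_two_iff_integrable_sq measurable.aestronglyMeasurable).2
    ((integrable_prod_iff (measurable.pow_const 2).aestronglyMeasurable).2
      ⟨ae_of_all _ fun x => (memLp_tensorKernel_right hκ x).integrable_sq, ?_⟩)
  simp only [norm_pow, Real.norm_eq_abs, sq_abs, integral_tensorKernel_sq_right]
  exact Integrable.fintype_prod (f := fun j x =>
    ∫ t, taylorKernel α (κ j) x t ^ 2 ∂gaussianReal 0 1)
    fun j => (integrable_taylorKernel_sq hα (mem_multiIndices.1 hκ j)).integral_prod_left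

theorem memLp_taylorKernel_prod (hα : 1 < α) {k : ℕ} (hk : k ≤ α) :
    MemLp (fun p : ℝ × ℝ => taylorKernel α k p.1 p.2) 2
      ((gaussianReal 0 1).prod (gaussianReal 0 1)) :=
  (memLp_two_iff_integrable_sq (measurable_taylorKernel α k).aestronglyMeasurable).2
    (integrable_taylorKernel_sq hα hk)

theorem memLp_meanKernel (hα : 1 < α) {k : ℕ} (hk : k ≤ α) :
    MemLp (meanKernel α k) 2 (gaussianReal 0 1) :=
  memLp_two_integral_left (memLp_taylorKernel_prod hα hk)

theorem memLp_tensorMeanKernel (hα : 1 < α) {κ : Fin s → ℕ} (hκ : κ ∈ multiIndices α s) :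
    MemLp (tensorMeanKernel α κ) 2 (gaussian s) :=
  memLp_two_fintype_prod fun j => memLp_meanKernel hα (mem_multiIndices.1 hκ j)

namespace IsDerivSystem

theorem eq_integral_of_fin_zero {f : (Fin 0 → ℝ) → ℝ} {D : (Fin 0 → ℕ) → (Fin 0 → ℝ) → ℝ}
    (hD : IsDerivSystem α f D) (x : Fin 0 → ℝ) :
    f x = ∑ κ ∈ multiIndices α 0,
      ∫ t, tensorKernel α κ x t * D κ (anchors α κ t) ∂gaussian 0 := by
  have integrand_eq : ∀ (κ : Fin 0 → ℕ) (t : Fin 0 → ℝ),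
      tensorKernel α κ x t * D κ (anchors α κ t) = f x := fun κ t => by
    rw [Subsingleton.elim κ 0, Subsingleton.elim (anchors α 0 t) x, hD.zero, tensorKernel,
      Fin.prod_univ_zero, one_mul]
  simp [integrand_eq]

/-- Taylor's formula in the first variable, followed by the expansion of its coefficients in the
remaining variables. -/
theorem eq_sum_integral (hα : 0 < α) {f : (Fin s → ℝ) → ℝ}
    {D : (Fin s → ℕ) → (Fin s → ℝ) → ℝ} (hD : IsDerivSystem α f D)
    (hD_memLp : ∀ κ ∈ multiIndices α s, MemLp (fun t => D κ (anchors α κ t)) 2 (gaussian s))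
    (x : Fin s → ℝ) :
    f x = ∑ κ ∈ multiIndices α s,
      ∫ t, tensorKernel α κ x t * D κ (anchors α κ t) ∂gaussian s := by
  induction s with
  | zero => exact hD.eq_integral_of_fin_zero x
  | succ s ih =>
    obtain ⟨x₀, y, rfl⟩ : ∃ x₀ y, x = (Fin.cons x₀ y : Fin (s + 1) → ℝ) :=
      ⟨x 0, Fin.tail x, (Fin.cons_self_tail x).symm⟩
    have taylor := (hD.isDerivChain y).eq_sum_integral hα x₀
    simp only [cons_zero_zero, hD.zero] at taylor
    rw [taylor, sum_multiIndices_succ]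
    refine Finset.sum_congr rfl fun k hk => ?_
    have memLp_cons : ∀ κ ∈ multiIndices α s, MemLp (fun q : ℝ × (Fin s → ℝ) =>
        D (Fin.cons k κ) (Fin.cons (anchor α k q.1) (anchors α κ q.2))) 2
        ((gaussianReal 0 1).prod (gaussian s)) := fun κ hκ => by
      simpa only [Function.comp_def, anchors_cons] using
        (hD_memLp _ (cons_mem_multiIndices.2 ⟨hk, hκ⟩)).comp_measurePreserving
          (measurePreserving_cons s)
    have integrable : ∀ κ ∈ multiIndices α s, Integrable
        (fun t => tensorKernel α (Fin.cons k κ) (Fin.cons x₀ y) t *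
          D (Fin.cons k κ) (anchors α (Fin.cons k κ) t)) (gaussian (s + 1)) := fun κ hκ =>
      have hkκ := cons_mem_multiIndices.2 ⟨hk, hκ⟩
      (memLp_tensorKernel_right hkκ _).integrable_mul (hD_memLp _ hkκ)
    have expand : ∀ᵐ t ∂gaussianReal 0 1,
        taylorKernel α k x₀ t * D (Fin.cons k 0) (Fin.cons (anchor α k t) y) =
          ∑ κ ∈ multiIndices α s, ∫ z, tensorKernel α (Fin.cons k κ) (Fin.cons x₀ y)
            (Fin.cons t z) * D (Fin.cons k κ) (anchors α (Fin.cons k κ) (Fin.cons t z))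
            ∂gaussian s := by
      filter_upwards [(Finset.eventually_all _).2
        fun κ hκ => ae_memLp_two_prodMk_left (memLp_cons κ hκ)] with t ht
      rw [ih (hD.slice (Nat.lt_succ_iff.1 (Finset.mem_range.1 hk)) (anchor α k t)) ht y,
        Finset.mul_sum]
      simp only [tensorKernel_cons, anchors_cons, mul_assoc, integral_const_mul]
    rw [integral_congr_ae expand, integral_finsetSum _ fun κ hκ =>
      (integrable_comp_cons (integrable κ hκ)).integral_prod_left]
    exact Finset.sum_congr rfl fun κ hκ => (integral_gaussian_succ (integrable κ hκ)).symm

theorem integral_eq_sum_integral (hα : 1 < α) {f : (Fin s → ℝ) → ℝ}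
    {D : (Fin s → ℕ) → (Fin s → ℝ) → ℝ} (hD : IsDerivSystem α f D)
    (hD_memLp : ∀ κ ∈ multiIndices α s, MemLp (fun t => D κ (anchors α κ t)) 2 (gaussian s)) :
    ∫ x, f x ∂gaussian s = ∑ κ ∈ multiIndices α s,
      ∫ t, tensorMeanKernel α κ t * D κ (anchors α κ t) ∂gaussian s := by
  have integrable : ∀ κ ∈ multiIndices α s, Integrable (fun q : (Fin s → ℝ) × (Fin s → ℝ) =>
      tensorKernel α κ q.1 q.2 * D κ (anchors α κ q.2)) ((gaussian s).prod (gaussian s)) :=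
    fun κ hκ => (memLp_tensorKernel hα hκ).integrable_mul ((hD_memLp κ hκ).comp_snd _)
  simp only [hD.eq_sum_integral (zero_lt_one.trans hα) hD_memLp]
  rw [integral_finsetSum _ fun κ hκ => (integrable κ hκ).integral_prod_left]
  refine Finset.sum_congr rfl fun κ hκ => ?_
  rw [integral_integral_swap (integrable κ hκ)]
  simp only [integral_mul_const, integral_tensorKernel_left]

end IsDerivSystem

end Tensor

/-! ### Upper bounds for the minimal errors -/

section Upper

variable {α s n : ℕ} {γ : ℕ → ℝ}

/-- The product of the `γ j` with `κ j ≠ 0`, whose inverse is the factor of the derivative of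
order `κ` in `normSq`. -/
def weight (γ : ℕ → ℝ) (κ : Fin s → ℕ) : ℝ := ∏ j, if κ j = 0 then 1 else γ j

theorem weight_pos (hγ : ∀ j, 0 < γ j) (κ : Fin s → ℕ) : 0 < weight γ κ :=
  Finset.prod_pos fun j _ => by split_ifs <;> simp [hγ]

theorem sum_range_ite_mul {a : ℕ → ℝ} (ha : a 0 = 1) (g : ℝ) :
    ∑ k ∈ Finset.range (α + 1), (if k = 0 then 1 else g) * a k =
      1 + g * ∑ k ∈ Finset.range α, a (k + 1) := by
  rw [Finset.sum_range_succ', add_comm, Finset.mul_sum]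
  simp [ha]

theorem sum_weight_mul_prod {a : ℕ → ℝ} (ha : a 0 = 1) :
    ∑ κ ∈ multiIndices α s, weight γ κ * ∏ j, a (κ j) =
      ∏ j : Fin s, (1 + γ j * ∑ k ∈ Finset.range α, a (k + 1)) := by
  simp only [weight, ← Finset.prod_mul_distrib]
  rw [sum_multiIndices_prod fun j k => (if k = 0 then 1 else γ j) * a k]
  exact Finset.prod_congr rfl fun j _ => sum_range_ite_mul ha (γ j)

theorem normSq_eq (D : (Fin s → ℕ) → (Fin s → ℝ) → ℝ) :
    normSq α γ D = ∑ κ ∈ multiIndices α s, ENNReal.ofReal (weight γ κ)⁻¹ *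
      ∫⁻ x, ENNReal.ofReal (D κ (anchors α κ x) ^ 2) ∂gaussian s := rfl

theorem normSq_eq_ofReal (hγ : ∀ j, 0 < γ j) {D : (Fin s → ℕ) → (Fin s → ℝ) → ℝ}
    (hD_memLp : ∀ κ ∈ multiIndices α s, MemLp (fun t => D κ (anchors α κ t)) 2 (gaussian s)) :
    normSq α γ D = ENNReal.ofReal (∑ κ ∈ multiIndices α s,
      (weight γ κ)⁻¹ * ∫ t, D κ (anchors α κ t) ^ 2 ∂gaussian s) := by
  have inv_weight_nonneg : ∀ κ : Fin s → ℕ, 0 ≤ (weight γ κ)⁻¹ := fun κ =>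
    (inv_pos.2 (weight_pos hγ κ)).le
  rw [normSq_eq, ENNReal.ofReal_sum_of_nonneg fun κ _ =>
    mul_nonneg (inv_weight_nonneg κ) (integral_nonneg fun t => sq_nonneg _)]
  refine Finset.sum_congr rfl fun κ hκ => ?_
  rw [ENNReal.ofReal_mul (inv_weight_nonneg κ), ofReal_integral_eq_lintegral_ofReal
    (hD_memLp κ hκ).integrable_sq (ae_of_all _ fun t => sq_nonneg _)]

theorem IsDerivSystem.memLp_of_normSq_ne_top (hγ : ∀ j, 0 < γ j) {f : (Fin s → ℝ) → ℝ}
    {D : (Fin s → ℕ) → (Fin s → ℝ) → ℝ} (hD : IsDerivSystem α f D) (h_norm : normSq α γ D ≠ ⊤) :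
    ∀ κ ∈ multiIndices α s, MemLp (fun t => D κ (anchors α κ t)) 2 (gaussian s) := fun κ hκ => by
  have measurable : Measurable fun t => D κ (anchors α κ t) :=
    (hD.measurable κ (mem_multiIndices.1 hκ)).comp (measurable_anchors κ)
  refine (memLp_two_iff_integrable_sq measurable.aestronglyMeasurable).2
    ((lintegral_ofReal_ne_top_iff_integrable (measurable.pow_const 2).aestronglyMeasurable
      (ae_of_all _ fun t => sq_nonneg _)).1 fun h_top => h_norm ?_)
  rw [normSq_eq]
  refine ENNReal.sum_eq_top.2 ⟨κ, hκ, ?_⟩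
  rw [h_top, ENNReal.mul_top (ENNReal.ofReal_pos.2 (inv_pos.2 (weight_pos hγ κ))).ne']

/-- The squared norm of the representer of the error of the algorithm `f ↦ ∑ i, w i * f (p i)` in
terms of the anchored derivatives of `f`. -/
def errorSq (α : ℕ) (γ : ℕ → ℝ) (w : Fin n → ℝ) (p : Fin n → Fin s → ℝ) : ℝ :=
  ∑ κ ∈ multiIndices α s, weight γ κ *
    ∫ t, (tensorMeanKernel α κ t - ∑ i, w i * tensorKernel α κ (p i) t) ^ 2 ∂gaussian s

theorem memLp_error (hα : 1 < α) (w : Fin n → ℝ) (p : Fin n → Fin s → ℝ) {κ : Fin s → ℕ}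
    (hκ : κ ∈ multiIndices α s) :
    MemLp (fun t => tensorMeanKernel α κ t - ∑ i, w i * tensorKernel α κ (p i) t) 2
      (gaussian s) :=
  (memLp_tensorMeanKernel hα hκ).sub
    (memLp_finsetSum _ fun i _ => (memLp_tensorKernel_right hκ (p i)).const_mul (w i))

theorem IsDerivSystem.integral_sub_sum_eq (hα : 1 < α) {f : (Fin s → ℝ) → ℝ}
    {D : (Fin s → ℕ) → (Fin s → ℝ) → ℝ} (hD : IsDerivSystem α f D)
    (hD_memLp : ∀ κ ∈ multiIndices α s, MemLp (fun t => D κ (anchors α κ t)) 2 (gaussian s))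
    (w : Fin n → ℝ) (p : Fin n → Fin s → ℝ) :
    ∫ x, f x ∂gaussian s - ∑ i, w i * f (p i) = ∑ κ ∈ multiIndices α s,
      ∫ t, (tensorMeanKernel α κ t - ∑ i, w i * tensorKernel α κ (p i) t) *
        D κ (anchors α κ t) ∂gaussian s := by
  rw [hD.integral_eq_sum_integral hα hD_memLp]
  simp only [hD.eq_sum_integral (zero_lt_one.trans hα) hD_memLp, Finset.mul_sum]
  rw [Finset.sum_comm, ← Finset.sum_sub_distrib]
  refine Finset.sum_congr rfl fun κ hκ => ?_
  have integrable_mean : Integrable (fun t => tensorMeanKernel α κ t * D κ (anchors α κ t))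
      (gaussian s) := (memLp_tensorMeanKernel hα hκ).integrable_mul (hD_memLp κ hκ)
  have integrable_kernel : ∀ i ∈ Finset.univ, Integrable
      (fun t => w i * (tensorKernel α κ (p i) t * D κ (anchors α κ t))) (gaussian s) := fun i _ =>
    ((memLp_tensorKernel_right hκ (p i)).integrable_mul (hD_memLp κ hκ)).const_mul (w i)
  simp only [sub_mul, Finset.sum_mul, mul_assoc]
  rw [integral_sub integrable_mean (integrable_finsetSum _ integrable_kernel),
    integral_finsetSum _ integrable_kernel]
  simp only [integral_const_mul]

theorem sq_integral_sub_sum_le (hα : 1 < α) (hγ : ∀ j, 0 < γ j) {f : (Fin s → ℝ) → ℝ}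
    (hf : f ∈ unitBall α γ s) (w : Fin n → ℝ) (p : Fin n → Fin s → ℝ) :
    (∫ x, f x ∂gaussian s - ∑ i, w i * f (p i)) ^ 2 ≤ errorSq α γ w p := by
  obtain ⟨D, hD, norm_le⟩ := hf
  have hD_memLp := hD.memLp_of_normSq_ne_top hγ (ne_top_of_le_ne_top ENNReal.one_ne_top norm_le)
  rw [normSq_eq_ofReal hγ hD_memLp, ENNReal.ofReal_le_one] at norm_le
  rw [hD.integral_sub_sum_eq hα hD_memLp]
  refine (sq_sum_integral_mul_le _ (fun κ _ => weight_pos hγ κ)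
    (fun κ hκ => memLp_error hα w p hκ) hD_memLp).trans (mul_le_of_le_one_right ?_ norm_le)
  exact Finset.sum_nonneg fun κ _ =>
    mul_nonneg (weight_pos hγ κ).le (integral_nonneg fun t => sq_nonneg _)

theorem worstCaseError_le (hα : 1 < α) (hγ : ∀ j, 0 < γ j) (w : Fin n → ℝ)
    (p : Fin n → Fin s → ℝ) :
    worstCaseError α γ s w p ≤ ENNReal.ofReal √(errorSq α γ w p) :=
  iSup₂_le fun _ hf =>
    ENNReal.ofReal_le_ofReal (Real.abs_le_sqrt (sq_integral_sub_sum_le hα hγ hf w p))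

theorem minError_le_sqrt_errorSq (hα : 1 < α) (hγ : ∀ j, 0 < γ j) (w : Fin n → ℝ)
    (p : Fin n → Fin s → ℝ) :
    minError α γ s n ≤ ENNReal.ofReal √(errorSq α γ w p) :=
  (iInf_le_of_le w (iInf_le _ p)).trans (worstCaseError_le hα hγ w p)

theorem taylorKernel_zero (hα : 0 < α) (x t : ℝ) : taylorKernel α 0 x t = 1 := by
  simp [taylorKernel_of_lt hα]

theorem meanKernel_zero (hα : 0 < α) (t : ℝ) : meanKernel α 0 t = 1 := by
  simp [meanKernel, taylorKernel_zero hα]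

/-- The slope of the squared initial error in dimension one as a function of the weight. -/
def initialSlope (α : ℕ) : ℝ :=
  ∑ k ∈ Finset.range α, ∫ t, meanKernel α (k + 1) t ^ 2 ∂gaussianReal 0 1

/-- The slope, as a function of the weight, of the mean of the reproducing kernel of the
one-dimensional space over the diagonal. -/
def kernelSlope (α : ℕ) : ℝ :=
  ∑ k ∈ Finset.range α,
    ∫ x, ∫ t, taylorKernel α (k + 1) x t ^ 2 ∂gaussianReal 0 1 ∂gaussianReal 0 1

theorem initialSlope_nonneg (α : ℕ) : 0 ≤ initialSlope α :=
  Finset.sum_nonneg fun _ _ => integral_nonneg fun _ => sq_nonneg _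

theorem kernelSlope_nonneg (α : ℕ) : 0 ≤ kernelSlope α :=
  Finset.sum_nonneg fun _ _ => integral_nonneg fun _ => integral_nonneg fun _ => sq_nonneg _

theorem integral_tensorMeanKernel_sq (κ : Fin s → ℕ) :
    ∫ t, tensorMeanKernel α κ t ^ 2 ∂gaussian s =
      ∏ j, ∫ t, meanKernel α (κ j) t ^ 2 ∂gaussianReal 0 1 := by
  simp only [tensorMeanKernel, ← Finset.prod_pow]
  exact integral_fintype_prod_eq_prod fun j t => meanKernel α (κ j) t ^ 2

theorem sum_weight_mul_integral_tensorMeanKernel_sq (hα : 0 < α) :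
    ∑ κ ∈ multiIndices α s, weight γ κ * ∫ t, tensorMeanKernel α κ t ^ 2 ∂gaussian s =
      ∏ j : Fin s, (1 + γ j * initialSlope α) := by
  simp only [integral_tensorMeanKernel_sq]
  exact sum_weight_mul_prod (a := fun k => ∫ t, meanKernel α k t ^ 2 ∂gaussianReal 0 1)
    (by simp [meanKernel_zero hα])

theorem sum_weight_mul_integral_tensorKernel_sq (hα : 0 < α) :
    ∑ κ ∈ multiIndices α s, weight γ κ *
        ∫ x, ∫ t, tensorKernel α κ x t ^ 2 ∂gaussian s ∂gaussian s =
      ∏ j : Fin s, (1 + γ j * kernelSlope α) := by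
  simp only [integral_integral_tensorKernel_sq]
  exact sum_weight_mul_prod
    (a := fun k => ∫ x, ∫ t, taylorKernel α k x t ^ 2 ∂gaussianReal 0 1 ∂gaussianReal 0 1)
    (by simp [taylorKernel_zero hα])

theorem minError_zero_le (hα : 1 < α) (hγ : ∀ j, 0 < γ j) (s : ℕ) :
    minError α γ s 0 ≤ ENNReal.ofReal √(∏ j : Fin s, (1 + γ j * initialSlope α)) := by
  refine (minError_le_sqrt_errorSq hα hγ Fin.elim0 Fin.elim0).trans_eq ?_
  rw [← sum_weight_mul_integral_tensorMeanKernel_sq (zero_lt_one.trans hα)]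
  simp [errorSq]

theorem errorSq_inv_natCast (hn : n ≠ 0) (p : Fin n → Fin s → ℝ) :
    errorSq α γ (fun _ => (n : ℝ)⁻¹) p = ((n : ℝ) ^ 2)⁻¹ *
      ∑ κ ∈ multiIndices α s, weight γ κ * ∫ t, (∑ i, (tensorKernel α κ (p i) t -
        ∫ x, tensorKernel α κ x t ∂gaussian s)) ^ 2 ∂gaussian s := by
  have error_eq : ∀ (κ : Fin s → ℕ) (t : Fin s → ℝ),
      (tensorMeanKernel α κ t - ∑ i, (n : ℝ)⁻¹ * tensorKernel α κ (p i) t) ^ 2 =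
        ((n : ℝ) ^ 2)⁻¹ * (∑ i, (tensorKernel α κ (p i) t -
          ∫ x, tensorKernel α κ x t ∂gaussian s)) ^ 2 := fun κ t => by
    rw [integral_tensorKernel_left, Finset.sum_sub_distrib, ← Finset.mul_sum, Finset.sum_const,
      Finset.card_univ, Fintype.card_fin, nsmul_eq_mul]
    have : (n : ℝ) ≠ 0 := Nat.cast_ne_zero.2 hn
    field_simp
    ring
  simp only [errorSq, error_eq, integral_const_mul, Finset.mul_sum, mul_left_comm]

/-- The mean of `errorSq` over independent Gaussian points is at most the bound, so some points
attain it. -/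
theorem minError_le (hα : 1 < α) (hγ : ∀ j, 0 < γ j) (s : ℕ) (hn : n ≠ 0) :
    minError α γ s n ≤ ENNReal.ofReal √((∏ j : Fin s, (1 + γ j * kernelSlope α)) / n) := by
  obtain ⟨p, hp⟩ := exists_sum_integral_sum_sub_integral_sq_le (multiIndices α s)
    (fun κ _ => (weight_pos hγ κ).le) (fun κ hκ => memLp_tensorKernel hα hκ)
    (fun κ hκ x => memLp_tensorKernel_right hκ x) n
  rw [sum_weight_mul_integral_tensorKernel_sq (zero_lt_one.trans hα)] at hp
  refine (minError_le_sqrt_errorSq hα hγ (fun _ => (n : ℝ)⁻¹) p).trans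
    (ENNReal.ofReal_le_ofReal (Real.sqrt_le_sqrt ?_))
  rw [errorSq_inv_natCast hn]
  refine (mul_le_mul_of_nonneg_left hp (by positivity)).trans_eq ?_
  have : (n : ℝ) ≠ 0 := Nat.cast_ne_zero.2 hn
  generalize ∏ j : Fin s, (1 + γ j * kernelSlope α) = P
  field_simp

end Upper

/-! ### Functions with prescribed anchored derivatives -/

section Prescribed

/-- The function of one variable with derivatives `d k` of order `k < α` at `0` and with derivative
`G` of order `α`, together with its derivatives. -/
def anchoredChain : ℕ → (ℕ → ℝ) → (ℝ → ℝ) → ℕ → ℝ → ℝ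
  | 0, _, G, _ => G
  | α + 1, d, G, 0 =>
    fun x => d 0 + ∫ t in (0 : ℝ)..x, anchoredChain α (fun k => d (k + 1)) G 0 t
  | α + 1, d, G, k + 1 => anchoredChain α (fun k => d (k + 1)) G k

variable {α : ℕ} {G : ℝ → ℝ}

theorem anchoredChain_self (α : ℕ) (d : ℕ → ℝ) (G : ℝ → ℝ) : anchoredChain α d G α = G := by
  induction α generalizing d with
  | zero => rfl
  | succ _ ih => exact ih _

theorem anchoredChain_apply_zero {k : ℕ} (hk : k < α) (d : ℕ → ℝ) (G : ℝ → ℝ) :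
    anchoredChain α d G k 0 = d k := by
  induction α generalizing d k with
  | zero => exact absurd hk k.not_lt_zero
  | succ α ih =>
    cases k with
    | zero => simp [anchoredChain]
    | succ k => exact ih (Nat.lt_of_succ_lt_succ hk) _

theorem intervalIntegrable_anchoredChain (hG_int : ∀ a b, IntervalIntegrable G volume a b)
    (d : ℕ → ℝ) (k : ℕ) (a b : ℝ) : IntervalIntegrable (anchoredChain α d G k) volume a b := by
  induction α generalizing d k a b with
  | zero => exact hG_int a b
  | succ α ih =>
    cases k with
    | zero => exact (continuous_const.add
        (intervalIntegral.continuous_primitive (ih _ 0) 0)).intervalIntegrable a b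
    | succ k => exact ih _ k a b

theorem measurable_anchoredChain (hG : Measurable G)
    (hG_int : ∀ a b, IntervalIntegrable G volume a b) (d : ℕ → ℝ) (k : ℕ) :
    Measurable (anchoredChain α d G k) := by
  induction α generalizing d k with
  | zero => exact hG
  | succ α ih =>
    cases k with
    | zero => exact (continuous_const.add (intervalIntegral.continuous_primitive
        (intervalIntegrable_anchoredChain hG_int _ 0) 0)).measurable
    | succ k => exact ih _ k

theorem isDerivChain_anchoredChain (hG : Measurable G)
    (hG_int : ∀ a b, IntervalIntegrable G volume a b) (α : ℕ) (d : ℕ → ℝ) :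
    IsDerivChain α (anchoredChain α d G) where
  measurable k _ := measurable_anchoredChain hG hG_int d k
  intervalIntegrable k _ a b := intervalIntegrable_anchoredChain hG_int d (k + 1) a b
  sub_eq_integral k hk a b := by
    induction α generalizing d k with
    | zero => exact absurd hk k.not_lt_zero
    | succ α ih =>
      cases k with
      | zero =>
        have intervalIntegrable := intervalIntegrable_anchoredChain (α := α) hG_int
          (fun k => d (k + 1)) 0
        simp only [anchoredChain, add_sub_add_left_eq_sub]
        exact intervalIntegral.integral_interval_sub_left
          (intervalIntegrable 0 b) (intervalIntegrable 0 a)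
      | succ k => exact ih _ k (Nat.lt_of_succ_lt_succ hk)

theorem intervalIntegrable_of_integrable_gaussianReal (hG : Integrable G (gaussianReal 0 1))
    (a b : ℝ) : IntervalIntegrable G volume a b := by
  rw [gaussianReal_of_var_ne_zero 0 one_ne_zero,
    integrable_withDensity_iff_integrable_smul' (measurable_gaussianPDF 0 1)
      (ae_of_all _ fun _ => ENNReal.ofReal_lt_top)] at hG
  have pdf_ne_zero : ∀ t, gaussianPDFReal 0 1 t ≠ 0 := fun t =>
    (gaussianPDFReal_pos 0 1 t one_ne_zero).ne'
  have continuous_inv_pdf : Continuous fun t => (gaussianPDFReal 0 1 t)⁻¹ := by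
    refine Continuous.inv₀ ?_ pdf_ne_zero
    unfold gaussianPDFReal
    fun_prop
  refine (hG.intervalIntegrable.continuousOn_mul continuous_inv_pdf.continuousOn).congr
    fun t _ => ?_
  rw [gaussianPDF, ENNReal.toReal_ofReal (gaussianPDFReal_nonneg 0 1 t), smul_eq_mul,
    inv_mul_cancel_left₀ (pdf_ne_zero t)]

variable {s : ℕ}

theorem isDerivSystem_prod {q : Fin s → ℕ → ℝ → ℝ} (hq : ∀ j, IsDerivChain α (q j)) :
    IsDerivSystem α (fun x => ∏ j, q j 0 (x j)) fun τ x => ∏ j, q j (τ j) (x j) := by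
  have prod_update : ∀ (τ : Fin s → ℕ) j x t, ∏ i, q i (τ i) (Function.update x j t i) =
      (∏ i ∈ Finset.univ.erase j, q i (τ i) (x i)) * q j (τ j) t := fun τ j x t => by
    rw [← Finset.prod_erase_mul _ _ (Finset.mem_univ j), Function.update_self]
    congr 1
    refine Finset.prod_congr rfl fun i hi => ?_
    rw [Function.update_of_ne (Finset.ne_of_mem_erase hi)]
  have prod_add_single_update : ∀ (τ : Fin s → ℕ) j x t,
      ∏ i, q i ((τ + Pi.single j 1 : Fin s → ℕ) i) (Function.update x j t i) =
        (∏ i ∈ Finset.univ.erase j, q i (τ i) (x i)) * q j (τ j + 1) t := fun τ j x t => by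
    rw [prod_update, Pi.add_apply, Pi.single_eq_same]
    congr 1
    refine Finset.prod_congr rfl fun i hi => ?_
    rw [Pi.add_apply, Pi.single_eq_of_ne (Finset.ne_of_mem_erase hi), add_zero]
  refine ⟨rfl, fun τ hτ => ?_, fun τ _ j hj x a b => ?_, fun τ _ j hj x a b => ?_⟩
  · exact Finset.measurable_prod _ fun j _ =>
      ((hq j).measurable _ (hτ j)).comp (measurable_pi_apply j)
  · simp only [prod_add_single_update]
    exact ((hq j).intervalIntegrable _ hj a b).const_mul _
  · simp only [prod_add_single_update, prod_update]
    rw [intervalIntegral.integral_const_mul, ← (hq j).sub_eq_integral _ hj, mul_sub]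

namespace IsDerivSystem

theorem const_mul {f : (Fin s → ℝ) → ℝ} {D : (Fin s → ℕ) → (Fin s → ℝ) → ℝ}
    (hD : IsDerivSystem α f D) (c : ℝ) :
    IsDerivSystem α (fun x => c * f x) fun τ x => c * D τ x where
  zero := by simp only [hD.zero]
  measurable τ hτ := (hD.measurable τ hτ).const_mul c
  intervalIntegrable τ hτ j hj x a b := (hD.intervalIntegrable τ hτ j hj x a b).const_mul c
  sub_eq_integral τ hτ j hj x a b := by
    rw [intervalIntegral.integral_const_mul, ← hD.sub_eq_integral τ hτ j hj, mul_sub]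

theorem sum {ι : Type*} (I : Finset ι) {f : ι → (Fin s → ℝ) → ℝ}
    {D : ι → (Fin s → ℕ) → (Fin s → ℝ) → ℝ} (hD : ∀ i, IsDerivSystem α (f i) (D i)) :
    IsDerivSystem α (fun x => ∑ i ∈ I, f i x) fun τ x => ∑ i ∈ I, D i τ x where
  zero := by simp only [(hD _).zero]
  measurable τ hτ := Finset.measurable_sum I fun i _ => (hD i).measurable τ hτ
  intervalIntegrable τ hτ j hj x a b := by
    simpa only [Finset.sum_fn] using IntervalIntegrable.sum I fun i _ =>
      (hD i).intervalIntegrable τ hτ j hj x a b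
  sub_eq_integral τ hτ j hj x a b := by
    rw [intervalIntegral.integral_finsetSum fun i _ => (hD i).intervalIntegrable τ hτ j hj x a b,
      ← Finset.sum_sub_distrib]
    exact Finset.sum_congr rfl fun i _ => (hD i).sub_eq_integral τ hτ j hj x a b

end IsDerivSystem

end Prescribed

/-! ### The fooling functions of the lower bound -/

section Fooling

variable {α s n : ℕ} {γ : ℕ → ℝ}

theorem normSq_const_mul (c : ℝ) (D : (Fin s → ℕ) → (Fin s → ℝ) → ℝ) :
    normSq α γ (fun τ x => c * D τ x) = ENNReal.ofReal (c ^ 2) * normSq α γ D := by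
  simp only [normSq_eq, mul_pow, ENNReal.ofReal_mul (sq_nonneg c), Finset.mul_sum]
  refine Finset.sum_congr rfl fun κ _ => ?_
  rw [lintegral_const_mul' _ _ ENNReal.ofReal_ne_top, mul_left_comm]

/-- A function vanishing at the nodes whose integral equals its squared norm fools the
algorithm after normalization. -/
theorem ofReal_sqrt_le_worstCaseError {h : (Fin s → ℝ) → ℝ}
    {D : (Fin s → ℕ) → (Fin s → ℝ) → ℝ} (hD : IsDerivSystem α h D) {T : ℝ}
    (h_norm : normSq α γ D ≤ ENNReal.ofReal T) (h_integral : ∫ x, h x ∂gaussian s = T)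
    (w : Fin n → ℝ) {p : Fin n → Fin s → ℝ} (h_zero : ∀ i, h (p i) = 0) :
    ENNReal.ofReal √T ≤ worstCaseError α γ s w p := by
  rcases le_or_gt T 0 with hT | hT
  · simp [Real.sqrt_eq_zero_of_nonpos hT]
  have mem_unitBall : (fun x => (√T)⁻¹ * h x) ∈ unitBall α γ s := by
    refine ⟨_, hD.const_mul _, (normSq_const_mul _ D).trans_le ?_⟩
    calc ENNReal.ofReal ((√T)⁻¹ ^ 2) * normSq α γ D
        ≤ ENNReal.ofReal T⁻¹ * ENNReal.ofReal T := by
          rw [inv_pow, Real.sq_sqrt hT.le]; gcongr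
      _ = 1 := by
          rw [← ENNReal.ofReal_mul (inv_pos.2 hT).le, inv_mul_cancel₀ hT.ne', ENNReal.ofReal_one]
  refine le_trans (le_of_eq ?_) (le_iSup₂ (f := fun (f : (Fin s → ℝ) → ℝ) (_ : f ∈ unitBall α γ s)
    => ENNReal.ofReal |∫ x, f x ∂gaussian s - ∑ i, w i * f (p i)|) _ mem_unitBall)
  simp only [h_zero, mul_zero, Finset.sum_const_zero, sub_zero]
  rw [integral_const_mul, h_integral, inv_mul_eq_div, Real.div_sqrt,
    abs_of_nonneg (Real.sqrt_nonneg T)]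

/-- The label of a derivative of order `k` at `t`: the derivatives of order `k < α`, taken at the
anchor, are labelled `none`, and those of order `α` are labelled by the sign of `t`. -/
def label (α k : ℕ) (t : ℝ) : Option Bool := if k < α then none else some (decide (0 < t))

/-- The anchored derivatives of `component α g l`: those of the representer of the Gaussian
integral in the space of functions of one variable of weight `g`, restricted to the label `l`. -/
def coeff (α : ℕ) (g : ℝ) (l : Option Bool) (k : ℕ) (t : ℝ) : ℝ :=
  if label α k t = l then (if k = 0 then 1 else g) * meanKernel α k t else 0

/-- The component with label `l` of the representer of the Gaussian integral in the space of
functions of one variable of weight `g`, together with its derivatives. -/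
def component (α : ℕ) (g : ℝ) (l : Option Bool) : ℕ → ℝ → ℝ :=
  anchoredChain α (fun k => coeff α g l k 0) (coeff α g l α)

theorem measurableSet_label_eq (α k : ℕ) (l : Option Bool) :
    MeasurableSet {t | label α k t = l} := by
  unfold label
  split_ifs
  · exact MeasurableSet.const _
  · rcases l with _ | _ | _
    · simp
    · simpa [← Set.Iic_def] using measurableSet_Iic (a := (0 : ℝ))
    · simpa [← Set.Ioi_def] using measurableSet_Ioi (a := (0 : ℝ))

theorem memLp_coeff (hα : 1 < α) (g : ℝ) (l : Option Bool) {k : ℕ} (hk : k ≤ α) :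
    MemLp (coeff α g l k) 2 (gaussianReal 0 1) := by
  have coeff_eq_indicator : coeff α g l k = {t | label α k t = l}.indicator
      fun t => (if k = 0 then 1 else g) * meanKernel α k t := by
    ext t
    simp only [coeff, Set.indicator, Set.mem_ofPred_eq]
  rw [coeff_eq_indicator]
  exact ((memLp_meanKernel hα hk).const_mul _).indicator (measurableSet_label_eq α k l)

theorem measurable_meanKernel (α k : ℕ) : Measurable (meanKernel α k) :=
  (measurable_taylorKernel α k).stronglyMeasurable.integral_prod_left'.measurable

theorem measurable_coeff (α : ℕ) (g : ℝ) (l : Option Bool) (k : ℕ) :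
    Measurable (coeff α g l k) :=
  Measurable.ite (measurableSet_label_eq α k l) ((measurable_meanKernel α k).const_mul _)
    measurable_const

theorem isDerivChain_component (hα : 1 < α) (g : ℝ) (l : Option Bool) :
    IsDerivChain α (component α g l) :=
  isDerivChain_anchoredChain (measurable_coeff α g l α)
    (intervalIntegrable_of_integrable_gaussianReal
      ((memLp_coeff hα g l le_rfl).integrable one_le_two)) α _

theorem coeff_anchor (g : ℝ) (l : Option Bool) (k : ℕ) (t : ℝ) :
    coeff α g l k (anchor α k t) = coeff α g l k t := by
  by_cases hk : k < α
  · simp [coeff, label, meanKernel, taylorKernel_of_lt, hk]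
  · simp [anchor, hk]

theorem component_anchor {k : ℕ} (hk : k ≤ α) (g : ℝ) (l : Option Bool) (t : ℝ) :
    component α g l k (anchor α k t) = coeff α g l k t := by
  rw [← coeff_anchor]
  rcases hk.lt_or_eq with hk | rfl
  · simp [component, anchor, hk, anchoredChain_apply_zero]
  · rw [component, anchoredChain_self]

theorem taylorKernel_mul_coeff_eq_zero (g : ℝ) {l : Option Bool} {x : ℝ} (hl_none : l ≠ none)
    (hl_sign : l ≠ some (decide (0 < x))) {k : ℕ} (hk : k ≤ α) (t : ℝ) :
    taylorKernel α k x t * coeff α g l k t = 0 := by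
  rcases hk.lt_or_eq with hk | rfl
  · rw [coeff, label, if_pos hk, if_neg hl_none.symm, mul_zero]
  by_cases ht : t ∈ Set.uIoc 0 x
  · have sign_eq : decide (0 < t) = decide (0 < x) := by
      rw [Set.mem_uIoc] at ht
      grind
    rw [coeff, label, if_neg (lt_irrefl k), sign_eq, if_neg hl_sign.symm, mul_zero]
  · rw [taylorKernel_self, Set.indicator_of_notMem ht, mul_zero, zero_mul]

theorem component_eq_zero (hα : 1 < α) (g : ℝ) {l : Option Bool} {x : ℝ} (hl_none : l ≠ none)
    (hl_sign : l ≠ some (decide (0 < x))) : component α g l 0 x = 0 := by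
  rw [(isDerivChain_component hα g l).eq_sum_integral (zero_lt_one.trans hα) x]
  refine Finset.sum_eq_zero fun k hk => ?_
  have hk : k ≤ α := Nat.lt_succ_iff.1 (Finset.mem_range.1 hk)
  simp only [component_anchor hk, taylorKernel_mul_coeff_eq_zero g hl_none hl_sign hk,
    integral_zero]

/-- The part of the representer of the Gaussian integral with labels in `S`, together with its
derivatives. -/
def foolingSystem (α : ℕ) (γ : ℕ → ℝ) (S : Finset (Fin s → Option Bool)) (τ : Fin s → ℕ)
    (x : Fin s → ℝ) : ℝ :=
  ∑ l ∈ S, ∏ j : Fin s, component α (γ j) (l j) (τ j) (x j)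

/-- The squared norm of the part of the representer of the Gaussian integral with labels
in `S`. -/
def partSq (α : ℕ) (γ : ℕ → ℝ) (S : Finset (Fin s → Option Bool)) : ℝ :=
  ∑ κ ∈ multiIndices α s, weight γ κ * ∫ t in {t | (fun j => label α (κ j) (t j)) ∈ S},
    tensorMeanKernel α κ t ^ 2 ∂gaussian s

theorem isDerivSystem_foolingSystem (hα : 1 < α) (γ : ℕ → ℝ) (S : Finset (Fin s → Option Bool)) :
    IsDerivSystem α (foolingSystem α γ S 0) (foolingSystem α γ S) :=
  IsDerivSystem.sum S fun l => isDerivSystem_prod fun j => isDerivChain_component hα (γ j) (l j)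

theorem foolingSystem_anchors (γ : ℕ → ℝ) (S : Finset (Fin s → Option Bool)) {κ : Fin s → ℕ}
    (hκ : κ ∈ multiIndices α s) (t : Fin s → ℝ) :
    foolingSystem α γ S κ (anchors α κ t) = {t | (fun j => label α (κ j) (t j)) ∈ S}.indicator
      (fun t => weight γ κ * tensorMeanKernel α κ t) t := by
  have prod_coeff : ∀ l : Fin s → Option Bool, ∏ j : Fin s, coeff α (γ j) (l j) (κ j) (t j) =
      if (fun j => label α (κ j) (t j)) = l then weight γ κ * tensorMeanKernel α κ t else 0 :=
    fun l => by
      simp only [coeff, Finset.prod_ite_zero, Finset.mem_univ, true_imp_iff, funext_iff, weight,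
        tensorMeanKernel, Finset.prod_mul_distrib]
  simp only [foolingSystem, anchors, component_anchor (mem_multiIndices.1 hκ _), prod_coeff,
    Finset.sum_ite_eq, Set.indicator, Set.mem_ofPred_eq]

theorem setOf_label_mem_eq_biUnion (κ : Fin s → ℕ) (S : Finset (Fin s → Option Bool)) :
    {t : Fin s → ℝ | (fun j => label α (κ j) (t j)) ∈ S} =
      ⋃ l ∈ S, Set.univ.pi fun j => {t | label α (κ j) t = l j} := by
  ext t
  simp [← funext_iff]

theorem measurableSet_label_mem (κ : Fin s → ℕ) (S : Finset (Fin s → Option Bool)) :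
    MeasurableSet {t : Fin s → ℝ | (fun j => label α (κ j) (t j)) ∈ S} := by
  rw [setOf_label_mem_eq_biUnion]
  exact S.measurableSet_biUnion fun l _ =>
    MeasurableSet.univ_pi fun j => measurableSet_label_eq α (κ j) (l j)

theorem memLp_foolingSystem (hα : 1 < α) (γ : ℕ → ℝ) (S : Finset (Fin s → Option Bool))
    {κ : Fin s → ℕ} (hκ : κ ∈ multiIndices α s) :
    MemLp (fun t => foolingSystem α γ S κ (anchors α κ t)) 2 (gaussian s) := by
  simp only [foolingSystem_anchors γ S hκ]
  exact ((memLp_tensorMeanKernel hα hκ).const_mul (weight γ κ)).indicator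
    (measurableSet_label_mem κ S)

theorem normSq_foolingSystem (hα : 1 < α) (hγ : ∀ j, 0 < γ j)
    (S : Finset (Fin s → Option Bool)) :
    normSq α γ (foolingSystem α γ S) = ENNReal.ofReal (partSq α γ S) := by
  rw [normSq_eq_ofReal hγ fun κ hκ => memLp_foolingSystem hα γ S hκ, partSq]
  congr 1
  refine Finset.sum_congr rfl fun κ hκ => ?_
  have weight_ne_zero := (weight_pos hγ κ).ne'
  rw [← integral_indicator (measurableSet_label_mem κ S), ← integral_const_mul,
    ← integral_const_mul]
  congr 1 with t
  rw [foolingSystem_anchors γ S hκ]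
  simp only [Set.indicator]
  split_ifs <;> field_simp
  ring

theorem integral_foolingSystem (hα : 1 < α) (γ : ℕ → ℝ) (S : Finset (Fin s → Option Bool)) :
    ∫ x, foolingSystem α γ S 0 x ∂gaussian s = partSq α γ S := by
  rw [(isDerivSystem_foolingSystem hα γ S).integral_eq_sum_integral hα
    fun κ hκ => memLp_foolingSystem hα γ S hκ]
  refine Finset.sum_congr rfl fun κ hκ => ?_
  rw [← integral_indicator (measurableSet_label_mem κ S), ← integral_const_mul]
  congr 1 with t
  rw [foolingSystem_anchors γ S hκ]
  simp only [Set.indicator]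
  split_ifs <;> ring

theorem foolingSystem_eq_zero (hα : 1 < α) (γ : ℕ → ℝ) {S : Finset (Fin s → Option Bool)}
    {x : Fin s → ℝ} (hS : ∀ l ∈ S, ∃ j, l j ≠ none ∧ l j ≠ some (decide (0 < x j))) :
    foolingSystem α γ S 0 x = 0 :=
  Finset.sum_eq_zero fun l hl =>
    have ⟨j, hj_none, hj_sign⟩ := hS l hl
    Finset.prod_eq_zero (Finset.mem_univ j) (component_eq_zero hα (γ j) hj_none hj_sign)

theorem ofReal_sqrt_partSq_le_worstCaseError (hα : 1 < α) (hγ : ∀ j, 0 < γ j) (w : Fin n → ℝ)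
    (p : Fin n → Fin s → ℝ) {S : Finset (Fin s → Option Bool)}
    (hS : ∀ l ∈ S, ∀ i, ∃ j, l j ≠ none ∧ l j ≠ some (decide (0 < p i j))) :
    ENNReal.ofReal √(partSq α γ S) ≤ worstCaseError α γ s w p :=
  ofReal_sqrt_le_worstCaseError (isDerivSystem_foolingSystem hα γ S)
    (normSq_foolingSystem hα hγ S).le (integral_foolingSystem hα γ S) w fun i =>
    foolingSystem_eq_zero hα γ fun l hl => hS l hl i

end Fooling

/-! ### Lower bounds for the minimal errors -/

section Lower

variable {α s : ℕ} {γ : ℕ → ℝ}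

theorem abs_taylorKernel_self (hα : 0 < α) (x t : ℝ) :
    |taylorKernel α α x t| = (if 0 < t then 1 else (-1) ^ α) * taylorKernel α α x t := by
  have pdf_nonneg := gaussianPDFReal_nonneg 0 1 t
  rw [taylorKernel_self]
  by_cases ht : t ∈ Set.uIoc 0 x
  · rw [Set.indicator_of_mem ht]
    rcases Set.mem_uIoc.1 ht with ⟨ht_pos, ht_le⟩ | ⟨ht_gt, ht_nonpos⟩
    · rw [if_pos (ht_pos.le.trans ht_le), if_pos ht_pos, one_mul, one_mul]
      exact abs_of_nonneg (div_nonneg (div_nonneg (pow_nonneg (sub_nonneg.2 ht_le) _)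
        (Nat.cast_nonneg _)) pdf_nonneg)
    · obtain ⟨m, rfl⟩ := Nat.exists_eq_succ_of_ne_zero hα.ne'
      have sign_mul : (-1 : ℝ) ^ (m + 1) * (-1 * (x - t) ^ m) = |(x - t) ^ m| := by
        rw [abs_pow, abs_of_neg (sub_neg.2 ht_gt), neg_pow (x - t)]
        ring
      rw [if_neg (ht_gt.trans_le ht_nonpos).not_ge, if_neg ht_nonpos.not_gt, abs_mul, abs_neg,
        abs_one, one_mul, abs_div, abs_div, Nat.abs_cast, abs_of_nonneg pdf_nonneg,
        Nat.succ_sub_one, Nat.succ_eq_add_one, ← sign_mul]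
      ring
  · simp only [Set.indicator_of_notMem ht, mul_zero, abs_zero]

theorem taylorKernel_self_ne_zero {x t : ℝ} (ht : t ∈ Set.uIoc 0 x) (hxt : x ≠ t) :
    taylorKernel α α x t ≠ 0 := by
  have pdf_ne_zero := (gaussianPDFReal_pos 0 1 t one_ne_zero).ne'
  rw [taylorKernel_self, Set.indicator_of_mem ht]
  refine mul_ne_zero (by split_ifs <;> norm_num) (div_ne_zero (div_ne_zero
    (pow_ne_zero _ (sub_ne_zero.2 hxt)) (Nat.cast_ne_zero.2 (Nat.factorial_ne_zero _))) pdf_ne_zero)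

instance isOpenPosMeasure_gaussianReal : (gaussianReal 0 1).IsOpenPosMeasure :=
  (gaussianReal_absolutelyContinuous' 0 one_ne_zero).isOpenPosMeasure

theorem meanKernel_self_ne_zero (hα : 0 < α) {t : ℝ}
    (h_int : Integrable (fun x => taylorKernel α α x t) (gaussianReal 0 1)) :
    meanKernel α α t ≠ 0 := by
  intro meanKernel_eq_zero
  have integral_abs : ∫ x, |taylorKernel α α x t| ∂gaussianReal 0 1 = 0 := by
    simp only [abs_taylorKernel_self hα]
    rw [integral_const_mul, ← meanKernel, meanKernel_eq_zero, mul_zero]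
  have ae_eq_zero : ∀ᵐ x ∂gaussianReal 0 1, |taylorKernel α α x t| = 0 :=
    (integral_eq_zero_iff_of_nonneg (fun x => abs_nonneg _) h_int.abs).1 integral_abs
  obtain ⟨U, hU, hU_nonempty, hU_mem⟩ : ∃ U : Set ℝ, IsOpen U ∧ U.Nonempty ∧
      ∀ x ∈ U, t ∈ Set.uIoc 0 x ∧ x ≠ t := by
    rcases lt_or_ge 0 t with ht | ht
    · exact ⟨Set.Ioi t, isOpen_Ioi, Set.nonempty_Ioi, fun x hx =>
        ⟨Set.mem_uIoc.2 (.inl ⟨ht, (Set.mem_Ioi.1 hx).le⟩), (Set.mem_Ioi.1 hx).ne'⟩⟩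
    · exact ⟨Set.Iio t, isOpen_Iio, Set.nonempty_Iio, fun x hx =>
        ⟨Set.mem_uIoc.2 (.inr ⟨hx, ht⟩), (Set.mem_Iio.1 hx).ne⟩⟩
  refine (hU.measure_pos (gaussianReal 0 1) hU_nonempty).ne' (measure_mono_null ?_ ae_eq_zero)
  exact fun x hx => abs_ne_zero.2 (taylorKernel_self_ne_zero (hU_mem x hx).1 (hU_mem x hx).2)

/-- The squared norm of the part of `meanKernel α α` on one of the half-lines. -/
def halfSq (α : ℕ) (b : Bool) : ℝ :=
  ∫ t in {t | decide (0 < t) = b}, meanKernel α α t ^ 2 ∂gaussianReal 0 1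

theorem halfSq_pos (hα : 1 < α) (b : Bool) : 0 < halfSq α b := by
  have meanKernel_ne_zero : ∀ᵐ t ∂gaussianReal 0 1, meanKernel α α t ≠ 0 := by
    filter_upwards [ae_memLp_two_prodMk_right (memLp_taylorKernel_prod hα le_rfl)] with t ht
    exact meanKernel_self_ne_zero (zero_lt_one.trans hα) (ht.integrable one_le_two)
  obtain ⟨U, hU, hU_nonempty, hU_subset⟩ : ∃ U : Set ℝ, IsOpen U ∧ U.Nonempty ∧
      U ⊆ {t | decide (0 < t) = b} := by
    cases b
    · exact ⟨Set.Iio 0, isOpen_Iio, Set.nonempty_Iio, fun t ht =>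
        decide_eq_false (Set.mem_Iio.1 ht).not_gt⟩
    · exact ⟨Set.Ioi 0, isOpen_Ioi, Set.nonempty_Ioi, fun t ht => decide_eq_true ht⟩
  rw [halfSq, setIntegral_pos_iff_support_of_nonneg_ae (ae_of_all _ fun t => sq_nonneg _)
    (memLp_meanKernel hα le_rfl).integrable_sq.integrableOn]
  refine (hU.measure_pos (gaussianReal 0 1) hU_nonempty).trans_le (measure_mono_ae ?_)
  filter_upwards [meanKernel_ne_zero] with t ht htU
  exact ⟨pow_ne_zero 2 ht, hU_subset htU⟩

/-- The squared norm of the component with label `l` of the representer of the Gaussian integral in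
the space of functions of one variable of weight `g`. -/
def componentSq (α : ℕ) (g : ℝ) (l : Option Bool) : ℝ :=
  ∑ k ∈ Finset.range (α + 1), (if k = 0 then 1 else g) *
    ∫ t in {t | label α k t = l}, meanKernel α k t ^ 2 ∂gaussianReal 0 1

theorem componentSq_nonneg {g : ℝ} (hg : 0 ≤ g) (l : Option Bool) : 0 ≤ componentSq α g l :=
  Finset.sum_nonneg fun k _ => mul_nonneg (by split_ifs <;> simp [hg])
    (integral_nonneg fun t => sq_nonneg _)

theorem componentSq_some (hα : 0 < α) (g : ℝ) (b : Bool) :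
    componentSq α g (some b) = g * halfSq α b := by
  rw [componentSq, Finset.sum_range_succ, Finset.sum_eq_zero, zero_add]
  · simp [label, halfSq, hα.ne']
  · intro k hk
    simp [label, Finset.mem_range.1 hk]

theorem sum_componentSq (hα : 1 < α) (g : ℝ) :
    ∑ l, componentSq α g l = 1 + g * initialSlope α := by
  rw [initialSlope, ← sum_range_ite_mul
    (a := fun k => ∫ t, meanKernel α k t ^ 2 ∂gaussianReal 0 1) (by simp [meanKernel_zero
      (zero_lt_one.trans hα)])]
  simp only [componentSq]
  rw [Finset.sum_comm]
  refine Finset.sum_congr rfl fun k hk => ?_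
  have integrable_sq := (memLp_meanKernel hα
    (Nat.lt_succ_iff.1 (Finset.mem_range.1 hk))).integrable_sq
  have iUnion_eq_univ : ⋃ l, {t | label α k t = l} = Set.univ :=
    Set.iUnion_eq_univ_iff.2 fun t => ⟨label α k t, by rfl⟩
  rw [← Finset.mul_sum, ← integral_iUnion_fintype (measurableSet_label_eq α k)
    (fun l l' hl => Set.disjoint_left.2 fun t ht ht' => hl (ht.symm.trans ht'))
    fun l => integrable_sq.integrableOn, iUnion_eq_univ, setIntegral_univ]

theorem setIntegral_tensorMeanKernel_sq (κ : Fin s → ℕ) (l : Fin s → Option Bool) :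
    ∫ t in Set.univ.pi fun j => {t | label α (κ j) t = l j},
        tensorMeanKernel α κ t ^ 2 ∂gaussian s =
      ∏ j, ∫ t in {t | label α (κ j) t = l j}, meanKernel α (κ j) t ^ 2 ∂gaussianReal 0 1 := by
  simp only [tensorMeanKernel, ← Finset.prod_pow, gaussian]
  rw [Measure.restrict_pi_pi]
  exact integral_fintype_prod_eq_prod fun j t => meanKernel α (κ j) t ^ 2

theorem partSq_eq_sum_prod (hα : 1 < α) (γ : ℕ → ℝ) (S : Finset (Fin s → Option Bool)) :
    partSq α γ S = ∑ l ∈ S, ∏ j : Fin s, componentSq α (γ j) (l j) := by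
  have setIntegral_eq_sum : ∀ κ ∈ multiIndices α s,
      ∫ t in {t | (fun j => label α (κ j) (t j)) ∈ S}, tensorMeanKernel α κ t ^ 2 ∂gaussian s =
        ∑ l ∈ S, ∏ j, ∫ t in {t | label α (κ j) t = l j},
          meanKernel α (κ j) t ^ 2 ∂gaussianReal 0 1 := fun κ hκ => by
    rw [setOf_label_mem_eq_biUnion, integral_biUnion_finset]
    · simp only [setIntegral_tensorMeanKernel_sq]
    · exact fun l _ => MeasurableSet.univ_pi fun j => measurableSet_label_eq α (κ j) (l j)
    · exact fun l _ l' _ hl => Set.disjoint_left.2 fun t ht ht' => hl <| funext fun j =>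
        (ht j trivial).symm.trans (ht' j trivial)
    · exact fun l _ => (memLp_tensorMeanKernel hα hκ).integrable_sq.integrableOn
  rw [partSq, Finset.sum_congr rfl fun κ hκ => by rw [setIntegral_eq_sum κ hκ, Finset.mul_sum],
    Finset.sum_comm]
  refine Finset.sum_congr rfl fun l _ => ?_
  simp only [weight, ← Finset.prod_mul_distrib]
  exact sum_multiIndices_prod fun j k => (if k = 0 then 1 else γ j) *
    ∫ t in {t | label α k t = l j}, meanKernel α k t ^ 2 ∂gaussianReal 0 1

/-- The exponential rate, in the sum of the weights, at which the information complexity grows at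
least if the weights are at most `M`. -/
def lowerRate (α : ℕ) (M : ℝ) : ℝ :=
  min (halfSq α true) (halfSq α false) / (1 + M * initialSlope α)

variable {M g : ℝ}

theorem lowerRate_pos (hα : 1 < α) (hM : 0 ≤ M) : 0 < lowerRate α M :=
  div_pos (lt_min (halfSq_pos hα _) (halfSq_pos hα _))
    (by linarith [mul_nonneg hM (initialSlope_nonneg α)])

theorem lowerRate_mul_initialSq_le (hα : 1 < α) (hg : 0 ≤ g) (hgM : g ≤ M) (b : Bool) :
    lowerRate α M * (1 + g * initialSlope α) ≤ halfSq α b := by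
  have slope_nonneg := initialSlope_nonneg α
  have denominator_pos : 0 < 1 + M * initialSlope α := by
    linarith [mul_nonneg (hg.trans hgM) slope_nonneg]
  calc lowerRate α M * (1 + g * initialSlope α)
      ≤ lowerRate α M * (1 + M * initialSlope α) := by
        have := (lowerRate_pos hα (hg.trans hgM)).le
        gcongr
    _ = min (halfSq α true) (halfSq α false) := div_mul_cancel₀ _ denominator_pos.ne'
    _ ≤ halfSq α b := by cases b <;> simp

theorem componentSq_none_add_some_le (hα : 1 < α) (hg : 0 ≤ g) (hgM : g ≤ M) (b : Bool) :
    componentSq α g none + componentSq α g (some b) ≤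
      (1 + g * initialSlope α) * Real.exp (-(lowerRate α M * g)) := by
  have initialSq_nonneg : 0 ≤ 1 + g * initialSlope α := by
    linarith [mul_nonneg hg (initialSlope_nonneg α)]
  have sum_eq : componentSq α g none + componentSq α g (some b) =
      1 + g * initialSlope α - g * halfSq α !b := by
    rw [← sum_componentSq hα, Fintype.sum_option, Fintype.sum_bool,
      ← componentSq_some (zero_lt_one.trans hα)]
    cases b <;> simp only [Bool.not_true, Bool.not_false] <;> ring
  calc componentSq α g none + componentSq α g (some b)
      = 1 + g * initialSlope α - g * halfSq α !b := sum_eq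
    _ ≤ 1 + g * initialSlope α - g * (lowerRate α M * (1 + g * initialSlope α)) := by
        gcongr
        exact lowerRate_mul_initialSq_le hα hg hgM _
    _ = (1 + g * initialSlope α) * (-(lowerRate α M * g) + 1) := by ring
    _ ≤ (1 + g * initialSlope α) * Real.exp (-(lowerRate α M * g)) := by
        gcongr
        exact Real.add_one_le_exp _

theorem sum_biUnion_le {ι κ : Type*} [DecidableEq κ] (I : Finset ι) (A : ι → Finset κ)
    {f : κ → ℝ} (hf : ∀ l, 0 ≤ f l) : ∑ l ∈ I.biUnion A, f l ≤ ∑ i ∈ I, ∑ l ∈ A i, f l := by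
  rw [Finset.sum_sigma' I A fun _ l => f l]
  have image_snd : I.biUnion A = (I.sigma A).image Sigma.snd := by
    ext l
    simp
  rw [image_snd]
  exact Finset.sum_image_le_of_nonneg fun _ _ => hf _

/-- The labels of the components vanishing at all nodes: a component vanishes at `p i` if one of
its labels is the sign opposite to that of the coordinate of `p i`. -/
def unseenLabels {n : ℕ} (p : Fin n → Fin s → ℝ) : Finset (Fin s → Option Bool) :=
  {l | ∀ i, ∃ j, l j ≠ none ∧ l j ≠ some (decide (0 < p i j))}

theorem compl_unseenLabels {n : ℕ} (p : Fin n → Fin s → ℝ) :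
    (unseenLabels p)ᶜ = Finset.univ.biUnion fun i => Fintype.piFinset fun j =>
      {none, some (decide (0 < p i j))} := by
  ext l
  simp only [unseenLabels, Finset.mem_compl, Finset.mem_filter_univ, Finset.mem_biUnion,
    Finset.mem_univ, true_and, Fintype.mem_piFinset, Finset.mem_insert, Finset.mem_singleton]
  push Not
  simp only [or_iff_not_imp_left, ne_eq]

theorem sum_compl_unseenLabels_le (hα : 1 < α) (hγ : ∀ j, 0 ≤ γ j) (hγM : ∀ j, γ j ≤ M) {n : ℕ}
    (p : Fin n → Fin s → ℝ) :
    ∑ l ∈ (unseenLabels p)ᶜ, ∏ j : Fin s, componentSq α (γ j) (l j) ≤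
      n * ((∏ j : Fin s, (1 + γ j * initialSlope α)) *
        Real.exp (-(lowerRate α M * ∑ j : Fin s, γ j))) := by
  rw [compl_unseenLabels]
  calc _ ≤ ∑ i, ∑ l ∈ Fintype.piFinset fun j => {none, some (decide (0 < p i j))},
          ∏ j : Fin s, componentSq α (γ j) (l j) :=
        sum_biUnion_le _ _ fun l => Finset.prod_nonneg fun j _ => componentSq_nonneg (hγ j) _
    _ = ∑ i, ∏ j : Fin s, (componentSq α (γ j) none +
          componentSq α (γ j) (some (decide (0 < p i j)))) := by
        refine Finset.sum_congr rfl fun i _ => ?_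
        rw [← Finset.prod_univ_sum _ fun (j : Fin s) l => componentSq α (γ j) l]
        exact Finset.prod_congr rfl fun j _ => Finset.sum_pair (Option.some_ne_none _).symm
    _ ≤ ∑ _i : Fin n, ∏ j : Fin s,
          ((1 + γ j * initialSlope α) * Real.exp (-(lowerRate α M * γ j))) := by
        gcongr with i _ j
        · exact fun j _ => add_nonneg (componentSq_nonneg (hγ j) _) (componentSq_nonneg (hγ j) _)
        · exact componentSq_none_add_some_le hα (hγ j) (hγM j) _
    _ = _ := by
        rw [Finset.sum_const, Finset.card_fin, nsmul_eq_mul, Finset.prod_mul_distrib,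
          ← Real.exp_sum, Finset.sum_neg_distrib, Finset.mul_sum]

theorem le_partSq_unseenLabels (hα : 1 < α) (hγ : ∀ j, 0 ≤ γ j) (hγM : ∀ j, γ j ≤ M) {n : ℕ}
    (p : Fin n → Fin s → ℝ) :
    (∏ j : Fin s, (1 + γ j * initialSlope α)) *
        (1 - n * Real.exp (-(lowerRate α M * ∑ j : Fin s, γ j))) ≤
      partSq α γ (unseenLabels p) := by
  have sum_all : ∑ l : Fin s → Option Bool, ∏ j : Fin s, componentSq α (γ j) (l j) =
      ∏ j : Fin s, (1 + γ j * initialSlope α) := by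
    rw [← Fintype.prod_sum fun (j : Fin s) l => componentSq α (γ j) l]
    exact Finset.prod_congr rfl fun j _ => sum_componentSq hα (γ j)
  rw [← Finset.sum_add_sum_compl (unseenLabels p), ← partSq_eq_sum_prod hα] at sum_all
  linarith [sum_compl_unseenLabels_le hα hγ hγM p]

theorem le_minError (hα : 1 < α) (hγ : ∀ j, 0 < γ j) (hγM : ∀ j, γ j ≤ M) (s n : ℕ) :
    ENNReal.ofReal √((∏ j : Fin s, (1 + γ j * initialSlope α)) *
        (1 - n * Real.exp (-(lowerRate α M * ∑ j : Fin s, γ j)))) ≤ minError α γ s n :=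
  le_iInf₂ fun w p => (ENNReal.ofReal_le_ofReal (Real.sqrt_le_sqrt
    (le_partSq_unseenLabels hα (fun j => (hγ j).le) hγM p))).trans
    (ofReal_sqrt_partSq_le_worstCaseError hα hγ w p fun _ hl => Finset.mem_filter_univ _ |>.1 hl)

theorem minError_zero_eq (hα : 1 < α) (hγ : ∀ j, 0 < γ j) (hγM : ∀ j, γ j ≤ M) (s : ℕ) :
    minError α γ s 0 = ENNReal.ofReal √(∏ j : Fin s, (1 + γ j * initialSlope α)) :=
  (minError_zero_le hα hγ s).antisymm (by simpa using le_minError hα hγ hγM s 0)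

end Lower

/-! ### Bounds for the information complexity -/

section Complexity

variable {α : ℕ} {γ : ℕ → ℝ} {M ε : ℝ}

theorem one_le_prod_initialSlope (hγ : ∀ j, 0 ≤ γ j) (s : ℕ) :
    1 ≤ ∏ j : Fin s, (1 + γ j * initialSlope α) :=
  Finset.one_le_prod fun j _ =>
    le_add_of_nonneg_right (mul_nonneg (hγ j) (initialSlope_nonneg α))

theorem one_le_scale (hα : 1 < α) (hγ : ∀ j, 0 < γ j) (hγM : ∀ j, γ j ≤ M)
    (c : ErrorCriterion) (s : ℕ) : 1 ≤ c.scale α γ s := by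
  cases c with
  | absolute => exact le_rfl
  | normalized =>
    rw [ErrorCriterion.scale, minError_zero_eq hα hγ hγM]
    exact ENNReal.one_le_ofReal.2
      (Real.one_le_sqrt.2 (one_le_prod_initialSlope (fun j => (hγ j).le) s))

theorem scale_le (hα : 1 < α) (hγ : ∀ j, 0 < γ j) (c : ErrorCriterion) (s : ℕ) :
    c.scale α γ s ≤ ENNReal.ofReal √(∏ j : Fin s, (1 + γ j * initialSlope α)) := by
  cases c with
  | absolute =>
    exact ENNReal.one_le_ofReal.2
      (Real.one_le_sqrt.2 (one_le_prod_initialSlope (fun j => (hγ j).le) s))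
  | normalized => exact minError_zero_le hα hγ s

theorem le_natCast_of_minError_le (hα : 1 < α) (hγ : ∀ j, 0 < γ j) (hγM : ∀ j, γ j ≤ M)
    {c : ErrorCriterion} {s n : ℕ} (hε : 0 ≤ ε)
    (h : minError α γ s n ≤ ENNReal.ofReal ε * c.scale α γ s) :
    (1 - ε ^ 2) * Real.exp (lowerRate α M * ∑ j ∈ Finset.range s, γ j) ≤ n := by
  set P := ∏ j : Fin s, (1 + γ j * initialSlope α)
  have P_pos : 0 < P := one_pos.trans_le (one_le_prod_initialSlope (fun j => (hγ j).le) s)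
  rw [← Fin.sum_univ_eq_sum_range]
  set S := ∑ j : Fin s, γ j
  have sqrt_le : ENNReal.ofReal √(P * (1 - n * Real.exp (-(lowerRate α M * S)))) ≤
      ENNReal.ofReal (ε * √P) := by
    rw [ENNReal.ofReal_mul hε]
    exact ((le_minError hα hγ hγM s n).trans h).trans (by gcongr; exact scale_le hα hγ c s)
  rw [ENNReal.ofReal_le_ofReal_iff (by positivity), Real.sqrt_le_left (by positivity), mul_pow,
    Real.sq_sqrt P_pos.le, mul_comm (ε ^ 2), mul_le_mul_iff_right₀ P_pos, Real.exp_neg] at sqrt_le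
  rw [← le_div_iff₀ (Real.exp_pos _), div_eq_mul_inv]
  linarith

theorem minError_natCeil_le (hα : 1 < α) (hγ : ∀ j, 0 < γ j) (s : ℕ) (hε : 0 < ε) :
    minError α γ s ⌈ε⁻¹ ^ 2 * Real.exp (kernelSlope α * ∑ j ∈ Finset.range s, γ j)⌉₊ ≤
      ENNReal.ofReal ε := by
  set Y := ε⁻¹ ^ 2 * Real.exp (kernelSlope α * ∑ j ∈ Finset.range s, γ j) with hY
  have ceil_pos : 0 < ⌈Y⌉₊ := Nat.ceil_pos.2 (by positivity)
  refine (minError_le hα hγ s ceil_pos.ne').trans (ENNReal.ofReal_le_ofReal ?_)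
  rw [Real.sqrt_le_left hε.le, div_le_iff₀ (by exact_mod_cast ceil_pos)]
  calc ∏ j : Fin s, (1 + γ j * kernelSlope α) ≤ ∏ j : Fin s, Real.exp (kernelSlope α * γ j) := by
        gcongr with j
        · exact fun j _ => add_nonneg zero_le_one (mul_nonneg (hγ j).le (kernelSlope_nonneg α))
        · rw [add_comm, mul_comm]
          exact Real.add_one_le_exp _
    _ = ε ^ 2 * Y := by
        rw [← Real.exp_sum, ← Finset.mul_sum, Fin.sum_univ_eq_sum_range, hY]
        field_simp
    _ ≤ ε ^ 2 * ⌈Y⌉₊ := by gcongr; exact Nat.le_ceil Y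

theorem exists_infoComplexity_eq (hα : 1 < α) (hγ : ∀ j, 0 < γ j) (hγM : ∀ j, γ j ≤ M)
    (c : ErrorCriterion) (s : ℕ) (hε : 0 < ε) :
    ∃ n : ℕ, infoComplexity c α γ s ε = n ∧
      minError α γ s n ≤ ENNReal.ofReal ε * c.scale α γ s ∧
      n ≤ ⌈ε⁻¹ ^ 2 * Real.exp (kernelSlope α * ∑ j ∈ Finset.range s, γ j)⌉₊ := by
  set A := {n : ℕ | minError α γ s n ≤ ENNReal.ofReal ε * c.scale α γ s}
  have ceil_mem : ⌈ε⁻¹ ^ 2 * Real.exp (kernelSlope α * ∑ j ∈ Finset.range s, γ j)⌉₊ ∈ A :=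
    (minError_natCeil_le hα hγ s hε).trans
      (le_mul_of_one_le_right zero_le (one_le_scale hα hγ hγM c s))
  have sInf_mem : sInf A ∈ A := Nat.sInf_mem ⟨_, ceil_mem⟩
  exact ⟨sInf A, le_antisymm (iInf₂_le (sInf A) sInf_mem)
    (le_iInf₂ fun n hn => Nat.cast_le.2 (Nat.sInf_le hn)), sInf_mem, Nat.sInf_le ceil_mem⟩

theorem infoComplexity_le (hα : 1 < α) (hγ : ∀ j, 0 < γ j) (hγM : ∀ j, γ j ≤ M)
    (c : ErrorCriterion) (s : ℕ) (hε : 0 < ε) (hε1 : ε < 1) :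
    (infoComplexity c α γ s ε : ℝ≥0∞) ≤ ENNReal.ofReal
      (2 * (ε⁻¹ ^ 2 * Real.exp (kernelSlope α * ∑ j ∈ Finset.range s, γ j))) := by
  obtain ⟨n, info_eq, -, n_le⟩ := exists_infoComplexity_eq hα hγ hγM c s hε
  set Y := ε⁻¹ ^ 2 * Real.exp (kernelSlope α * ∑ j ∈ Finset.range s, γ j)
  have one_le_Y : 1 ≤ Y :=
    one_le_mul_of_one_le_of_one_le (one_le_pow₀ ((one_le_inv₀ hε).2 hε1.le))
      (Real.one_le_exp (mul_nonneg (kernelSlope_nonneg α) (Finset.sum_nonneg fun j _ => (hγ j).le)))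
  rw [info_eq, ENat.toENNReal_coe, ← ENNReal.ofReal_natCast]
  refine ENNReal.ofReal_le_ofReal ?_
  linarith [Nat.cast_le (α := ℝ).2 n_le, Nat.ceil_lt_add_one (zero_le_one.trans one_le_Y)]

/-- The logarithm of the information complexity as a real number; it is meaningful when the
information complexity is finite and positive. -/
def logComplexity (c : ErrorCriterion) (α : ℕ) (γ : ℕ → ℝ) (s : ℕ) (ε : ℝ) : ℝ :=
  Real.log (infoComplexity c α γ s ε).toNat

theorem logComplexity_nonneg (c : ErrorCriterion) (α : ℕ) (γ : ℕ → ℝ) (s : ℕ) (ε : ℝ) :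
    0 ≤ logComplexity c α γ s ε :=
  Real.log_natCast_nonneg _

theorem infoComplexity_eq_ofReal_exp (hα : 1 < α) (hγ : ∀ j, 0 < γ j) (hγM : ∀ j, γ j ≤ M)
    (c : ErrorCriterion) (s : ℕ) (hε : 0 < ε) (hε1 : ε < 1) :
    (infoComplexity c α γ s ε : ℝ≥0∞) = ENNReal.ofReal (Real.exp (logComplexity c α γ s ε)) := by
  obtain ⟨n, info_eq, minError_le, -⟩ := exists_infoComplexity_eq hα hγ hγM c s hε
  have n_pos : (0 : ℝ) < n :=
    (mul_pos (by nlinarith) (Real.exp_pos _)).trans_le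
      (le_natCast_of_minError_le hα hγ hγM hε.le minError_le)
  rw [logComplexity, info_eq, ENat.toNat_natCast, Real.exp_log n_pos, ENNReal.ofReal_natCast,
    ENat.toENNReal_coe]

theorem log_infoComplexity (hα : 1 < α) (hγ : ∀ j, 0 < γ j) (hγM : ∀ j, γ j ≤ M)
    (c : ErrorCriterion) (s : ℕ) (hε : 0 < ε) (hε1 : ε < 1) :
    ENNReal.log (infoComplexity c α γ s ε : ℝ≥0∞) = (logComplexity c α γ s ε : EReal) := by
  rw [infoComplexity_eq_ofReal_exp hα hγ hγM c s hε hε1,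
    ENNReal.log_ofReal_of_pos (Real.exp_pos _), Real.log_exp]

theorem logComplexity_le (hα : 1 < α) (hγ : ∀ j, 0 < γ j) (hγM : ∀ j, γ j ≤ M)
    (c : ErrorCriterion) (s : ℕ) (hε : 0 < ε) (hε1 : ε < 1) :
    logComplexity c α γ s ε ≤
      Real.log 2 + 2 * Real.log ε⁻¹ + kernelSlope α * ∑ j ∈ Finset.range s, γ j := by
  have exp_le := infoComplexity_le hα hγ hγM c s hε hε1
  rw [infoComplexity_eq_ofReal_exp hα hγ hγM c s hε hε1,
    ENNReal.ofReal_le_ofReal_iff (by positivity), ← Real.le_log_iff_exp_le (by positivity),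
    Real.log_mul two_ne_zero (by positivity), Real.log_mul (by positivity) (Real.exp_pos _).ne',
    Real.log_exp, Real.log_pow] at exp_le
  exact exp_le.trans_eq (by push_cast; ring)

theorem lowerRate_mul_sum_le (hα : 1 < α) (hγ : ∀ j, 0 < γ j) (hγM : ∀ j, γ j ≤ M)
    (c : ErrorCriterion) (s : ℕ) :
    lowerRate α M * ∑ j ∈ Finset.range s, γ j ≤ 1 + logComplexity c α γ s (1 / 2) := by
  obtain ⟨n, info_eq, minError_le, -⟩ :=
    exists_infoComplexity_eq hα hγ hγM c s (ε := 1 / 2) (by norm_num)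
  have exp_le := le_natCast_of_minError_le hα hγ hγM (by norm_num) minError_le
  have n_pos : (0 : ℝ) < n := (by positivity : 0 < (1 - (1 / 2 : ℝ) ^ 2) * _).trans_le exp_le
  rw [logComplexity, info_eq, ENat.toNat_natCast, ← Real.log_exp 1,
    ← Real.log_mul (Real.exp_pos 1).ne' n_pos.ne', Real.le_log_iff_exp_le (by positivity)]
  nlinarith [Real.add_one_le_exp 1]

theorem lowerRate_mul_sum_le_of_infoComplexity_le (hα : 1 < α) (hγ : ∀ j, 0 < γ j)
    (hγM : ∀ j, γ j ≤ M) {c : ErrorCriterion} {s : ℕ} {r : ℝ} (hr : 0 < r)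
    (h : (infoComplexity c α γ s (1 / 2) : ℝ≥0∞) ≤ ENNReal.ofReal r) :
    lowerRate α M * ∑ j ∈ Finset.range s, γ j ≤ 1 + Real.log r := by
  rw [infoComplexity_eq_ofReal_exp hα hγ hγM c s (by norm_num) (by norm_num),
    ENNReal.ofReal_le_ofReal_iff hr.le, ← Real.le_log_iff_exp_le hr] at h
  linarith [lowerRate_mul_sum_le hα hγ hγM c s]

end Complexity

/-! ### Growth rates -/

section Growth

variable {ι : Type*} {l : Filter ι} {u g : ι → ℝ}

theorem exists_forall_le_add_of_eventually {u v : ℕ → ℝ} {B : ℝ}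
    (h : ∀ᶠ s in atTop, u s ≤ B + v s) : ∃ B', ∀ s, u s ≤ B' + v s := by
  have bounded : IsBoundedUnder (· ≤ ·) atTop fun s => u s - v s :=
    isBoundedUnder_of_eventually_le (h.mono fun s hs => sub_le_iff_le_add.2 hs)
  obtain ⟨B', hB'⟩ := bounded.bddAbove_range
  exact ⟨B', fun s => sub_le_iff_le_add.1 (hB' (Set.mem_range_self s))⟩

theorem tendsto_div_zero_iff_forall_exists_le (hu : ∀ᶠ x in l, 0 ≤ u x) (hg : Tendsto g l atTop) :
    Tendsto (fun x => u x / g x) l (𝓝 0) ↔ ∀ η > 0, ∃ B, ∀ᶠ x in l, u x ≤ B + η * g x := by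
  constructor
  · intro h η hη
    refine ⟨0, ?_⟩
    filter_upwards [h.eventually (gt_mem_nhds hη), hg.eventually_gt_atTop 0] with x hx hgx
    rw [zero_add]
    exact ((div_lt_iff₀ hgx).1 hx).le
  · refine fun h => tendsto_order.2 ⟨fun a ha => ?_, fun a ha => ?_⟩
    · filter_upwards [hu, hg.eventually_gt_atTop 0] with x hux hgx
      exact ha.trans_le (div_nonneg hux hgx.le)
    · obtain ⟨B, hB⟩ := h (a / 2) (half_pos ha)
      filter_upwards [hB, hg.eventually_gt_atTop 0, hg.eventually_gt_atTop (B / (a / 2))]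
        with x hux hgx hBx
      rw [div_lt_iff₀ hgx]
      rw [div_lt_iff₀ (half_pos ha)] at hBx
      linarith

theorem limsup_one_div_mul_lt_top_iff (hg : Tendsto g l atTop) :
    limsup (fun x => ((1 / g x * u x : ℝ) : EReal)) l < ⊤ ↔
      ∃ B K, ∀ᶠ x in l, u x ≤ B + K * g x := by
  constructor
  · intro h
    obtain ⟨K, limsup_lt, -⟩ := EReal.lt_iff_exists_real_btwn.1 h
    refine ⟨0, K, ?_⟩
    filter_upwards [eventually_lt_of_limsup_lt limsup_lt, hg.eventually_gt_atTop 0] with x hx hgx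
    rw [EReal.coe_lt_coe_iff, one_div_mul_eq_div, div_lt_iff₀ hgx] at hx
    linarith
  · rintro ⟨B, K, h⟩
    refine (limsup_le_of_le (a := ((|B| + K : ℝ) : EReal)) (by isBoundedDefault) ?_).trans_lt
      (EReal.coe_lt_top _)
    filter_upwards [h, hg.eventually_ge_atTop 1] with x hx hgx
    rw [EReal.coe_le_coe_iff, one_div_mul_eq_div, div_le_iff₀ (one_pos.trans_le hgx)]
    nlinarith [le_abs_self B, abs_nonneg B]

theorem exists_log_le_add_mul_rpow {η τ : ℝ} (hη : 0 < η) (hτ : 0 < τ) :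
    ∃ B, ∀ x : ℝ, 0 < x → Real.log x ≤ B + η * x ^ τ := by
  refine ⟨(-1 - Real.log (η * τ)) / τ, fun x hx => ?_⟩
  have log_le := Real.log_le_sub_one_of_pos (by positivity : 0 < η * τ * x ^ τ)
  rw [Real.log_mul (by positivity) (by positivity), Real.log_rpow hx] at log_le
  rw [← sub_le_iff_le_add, le_div_iff₀ hτ]
  linarith

end Growth

/-! ### Tractability -/

section Tractability

variable {α : ℕ} {γ : ℕ → ℝ} {c : ErrorCriterion} {M σ τ : ℝ}

theorem spt_iff_summable (hα : 1 < α) (hγ : ∀ j, 0 < γ j) (hγM : ∀ j, γ j ≤ M) :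
    SPT c α γ ↔ Summable γ := by
  constructor
  · rintro ⟨τ, C, -, hC, info_le⟩
    have rate_pos : 0 < lowerRate α M := lowerRate_pos hα ((hγ 0).le.trans (hγM 0))
    refine summable_of_sum_range_le (c := (1 + Real.log ((C + 1) * (1 / 2) ^ (-τ))) / lowerRate α M)
      (fun j => (hγ j).le) fun s => ?_
    have sum_le_sum_succ : ∑ j ∈ Finset.range s, γ j ≤ ∑ j ∈ Finset.range (s + 1), γ j := by
      rw [Finset.sum_range_succ]
      exact le_add_of_nonneg_right (hγ s).le
    refine sum_le_sum_succ.trans ((le_div_iff₀' rate_pos).2 ?_)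
    refine lowerRate_mul_sum_le_of_infoComplexity_le (c := c) hα hγ hγM (by positivity)
      ((info_le (s + 1) s.succ_pos (1 / 2) (by norm_num) (by norm_num)).trans ?_)
    gcongr
    exact le_add_of_nonneg_right zero_le_one
  · intro summable
    refine ⟨2, 2 * Real.exp (kernelSlope α * ∑' j, γ j), zero_le_two, by positivity,
      fun s _ ε hε hε1 => (infoComplexity_le hα hγ hγM c s hε hε1).trans ?_⟩
    rw [Real.rpow_neg hε.le, Real.rpow_two, inv_pow, mul_comm (ε ^ 2)⁻¹, ← mul_assoc]
    gcongr
    · exact kernelSlope_nonneg α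
    · exact summable.sum_le_tsum _ fun j _ => (hγ j).le

theorem pt_iff_limsup_lt_top (hα : 1 < α) (hγ : ∀ j, 0 < γ j) (hγM : ∀ j, γ j ≤ M) :
    PT c α γ ↔ limsup (fun s : ℕ =>
      (((1 / Real.log s) * ∑ j ∈ Finset.range s, γ j : ℝ) : EReal)) atTop < ⊤ := by
  rw [limsup_one_div_mul_lt_top_iff (g := fun s : ℕ => Real.log s)
    (Real.tendsto_log_atTop.comp tendsto_natCast_atTop_atTop)]
  constructor
  · rintro ⟨τ, σ, C, -, -, hC, info_le⟩
    have rate_pos : 0 < lowerRate α M := lowerRate_pos hα ((hγ 0).le.trans (hγM 0))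
    refine ⟨(1 + Real.log ((C + 1) * (1 / 2) ^ (-τ))) / lowerRate α M, σ / lowerRate α M, ?_⟩
    filter_upwards [eventually_ge_atTop 1] with s hs
    have s_pos : (0 : ℝ) < s := by exact_mod_cast hs
    rw [div_mul_eq_mul_div, ← add_div, le_div_iff₀' rate_pos, add_assoc, ← Real.log_rpow s_pos,
      ← Real.log_mul (by positivity) (by positivity)]
    refine lowerRate_mul_sum_le_of_infoComplexity_le (c := c) hα hγ hγM (by positivity)
      ((info_le s hs (1 / 2) (by norm_num) (by norm_num)).trans ?_)
    gcongr
    exact le_add_of_nonneg_right zero_le_one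
  · rintro ⟨B, K, sum_le_eventually⟩
    obtain ⟨B', sum_le⟩ := exists_forall_le_add_of_eventually sum_le_eventually
    have slope_nonneg := kernelSlope_nonneg α
    refine ⟨2, kernelSlope α * |K|, 2 * Real.exp (kernelSlope α * B'), zero_le_two, by positivity,
      by positivity, fun s hs ε hε hε1 => (infoComplexity_le hα hγ hγM c s hε hε1).trans ?_⟩
    have s_pos : (0 : ℝ) < s := by exact_mod_cast hs
    refine ENNReal.ofReal_le_ofReal ?_
    calc 2 * (ε⁻¹ ^ 2 * Real.exp (kernelSlope α * ∑ j ∈ Finset.range s, γ j))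
        ≤ 2 * (ε⁻¹ ^ 2 * Real.exp (kernelSlope α * (B' + |K| * Real.log s))) := by
          gcongr
          refine (sum_le s).trans ?_
          gcongr
          exact le_abs_self K
      _ = 2 * Real.exp (kernelSlope α * B') * ε ^ (-2 : ℝ) * (s : ℝ) ^ (kernelSlope α * |K|) := by
          rw [Real.rpow_neg hε.le, Real.rpow_two, inv_pow, Real.rpow_def_of_pos s_pos, mul_add,
            Real.exp_add]
          ring_nf

theorem eventually_sizeAtTop : ∀ᶠ q in sizeAtTop, 1 ≤ q.1 ∧ 0 < q.2 ∧ q.2 < 1 :=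
  eventually_inf_principal.2 (Eventually.of_forall fun _ h => h)

theorem tendsto_rpow_add_rpow_neg_sizeAtTop (hσ : 0 < σ) (hτ : 0 < τ) :
    Tendsto (fun q : ℕ × ℝ => (q.1 : ℝ) ^ σ + q.2 ^ (-τ)) sizeAtTop atTop := by
  have tendsto_half : Tendsto (fun q : ℕ × ℝ => ((q.1 : ℝ) + q.2⁻¹) / 2) sizeAtTop atTop :=
    (tendsto_comap.mono_left inf_le_left).atTop_div_const two_pos
  refine tendsto_atTop.2 fun R => ?_
  filter_upwards [((tendsto_rpow_atTop hσ).comp tendsto_half).eventually_ge_atTop R,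
    ((tendsto_rpow_atTop hτ).comp tendsto_half).eventually_ge_atTop R, eventually_sizeAtTop]
    with q le_rpow_σ le_rpow_τ ⟨_, hε, _⟩
  rw [Real.rpow_neg hε.le, ← Real.inv_rpow hε.le]
  rcases le_total (q.1 : ℝ) q.2⁻¹ with hle | hle
  · calc R ≤ (((q.1 : ℝ) + q.2⁻¹) / 2) ^ τ := le_rpow_τ
      _ ≤ q.2⁻¹ ^ τ := by gcongr; linarith
      _ ≤ _ := le_add_of_nonneg_left (by positivity)
  · calc R ≤ (((q.1 : ℝ) + q.2⁻¹) / 2) ^ σ := le_rpow_σ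
      _ ≤ (q.1 : ℝ) ^ σ := by gcongr; linarith
      _ ≤ _ := le_add_of_nonneg_right (by positivity)

theorem tendsto_prodMk_sizeAtTop {ε : ℝ} (hε : 0 < ε) (hε1 : ε < 1) :
    Tendsto (fun s : ℕ => (s, ε)) atTop sizeAtTop := by
  refine tendsto_inf.2 ⟨tendsto_comap_iff.2 ?_, tendsto_principal.2 ?_⟩
  · exact tendsto_atTop_add_const_right _ ε⁻¹ (tendsto_natCast_atTop_atTop (R := ℝ))
  · exact (eventually_ge_atTop 1).mono fun s hs => ⟨hs, hε, hε1⟩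

theorem stwt_iff_forall_exists_logComplexity_le (hα : 1 < α) (hγ : ∀ j, 0 < γ j)
    (hγM : ∀ j, γ j ≤ M) (hσ : 0 < σ) (hτ : 0 < τ) :
    STWT c α γ σ τ ↔ ∀ η > 0, ∃ B, ∀ᶠ q in sizeAtTop,
      logComplexity c α γ q.1 q.2 ≤ B + η * ((q.1 : ℝ) ^ σ + q.2 ^ (-τ)) := by
  rw [← tendsto_div_zero_iff_forall_exists_le
    (u := fun q : ℕ × ℝ => logComplexity c α γ q.1 q.2)
    (Eventually.of_forall fun _ => logComplexity_nonneg ..)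
    (tendsto_rpow_add_rpow_neg_sizeAtTop hσ hτ), ← EReal.tendsto_coe, EReal.coe_zero]
  refine tendsto_congr' ?_
  filter_upwards [eventually_sizeAtTop] with q ⟨_, hε, hε1⟩
  rw [log_infoComplexity hα hγ hγM c q.1 hε hε1, EReal.coe_div]

theorem forall_exists_sum_le_of_stwt (hα : 1 < α) (hγ : ∀ j, 0 < γ j) (hγM : ∀ j, γ j ≤ M)
    (hσ : 0 < σ) (hτ : 0 < τ) (h : STWT c α γ σ τ) :
    ∀ η > 0, ∃ B, ∀ᶠ s : ℕ in atTop, ∑ j ∈ Finset.range s, γ j ≤ B + η * (s : ℝ) ^ σ := by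
  intro η hη
  have rate_pos : 0 < lowerRate α M := lowerRate_pos hα ((hγ 0).le.trans (hγM 0))
  obtain ⟨B, log_le⟩ := (stwt_iff_forall_exists_logComplexity_le hα hγ hγM hσ hτ).1 h
    (lowerRate α M * η) (by positivity)
  refine ⟨(1 + B) / lowerRate α M + η * (1 / 2) ^ (-τ), ?_⟩
  filter_upwards [(tendsto_prodMk_sizeAtTop one_half_pos one_half_lt_one).eventually log_le]
    with s log_le_s
  rw [← mul_le_mul_iff_right₀ rate_pos]
  calc lowerRate α M * ∑ j ∈ Finset.range s, γ j
      ≤ 1 + logComplexity c α γ s (1 / 2) := lowerRate_mul_sum_le hα hγ hγM c s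
    _ ≤ 1 + (B + lowerRate α M * η * ((s : ℝ) ^ σ + (1 / 2) ^ (-τ))) := by gcongr
    _ = _ := by field_simp; ring

theorem stwt_of_forall_exists_sum_le (hα : 1 < α) (hγ : ∀ j, 0 < γ j) (hγM : ∀ j, γ j ≤ M)
    (hσ : 0 < σ) (hτ : 0 < τ)
    (h : ∀ η > 0, ∃ B, ∀ᶠ s : ℕ in atTop, ∑ j ∈ Finset.range s, γ j ≤ B + η * (s : ℝ) ^ σ) :
    STWT c α γ σ τ := by
  rw [stwt_iff_forall_exists_logComplexity_le hα hγ hγM hσ hτ]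
  intro η hη
  have slope_nonneg := kernelSlope_nonneg α
  obtain ⟨B, sum_le_eventually⟩ := h (η / (kernelSlope α + 1)) (by positivity)
  obtain ⟨B', sum_le⟩ := exists_forall_le_add_of_eventually sum_le_eventually
  obtain ⟨L, log_le⟩ := exists_log_le_add_mul_rpow (half_pos hη) hτ
  refine ⟨Real.log 2 + 2 * L + kernelSlope α * B', ?_⟩
  filter_upwards [eventually_sizeAtTop] with ⟨s, ε⟩ ⟨_, hε, hε1⟩
  have slope_le : kernelSlope α * (η / (kernelSlope α + 1)) ≤ η := by
    rw [mul_div_assoc', div_le_iff₀ (by positivity)]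
    linarith
  calc logComplexity c α γ s ε
      ≤ Real.log 2 + 2 * Real.log ε⁻¹ + kernelSlope α * ∑ j ∈ Finset.range s, γ j :=
        logComplexity_le hα hγ hγM c s hε hε1
    _ ≤ Real.log 2 + 2 * (L + η / 2 * ε⁻¹ ^ τ) +
          kernelSlope α * (B' + η / (kernelSlope α + 1) * (s : ℝ) ^ σ) := by
        gcongr
        · exact log_le _ (inv_pos.2 hε)
        · exact sum_le s
    _ = Real.log 2 + 2 * L + kernelSlope α * B' + (η * ε⁻¹ ^ τ +
          kernelSlope α * (η / (kernelSlope α + 1)) * (s : ℝ) ^ σ) := by ring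
    _ ≤ Real.log 2 + 2 * L + kernelSlope α * B' + (η * ε⁻¹ ^ τ + η * (s : ℝ) ^ σ) := by gcongr
    _ = _ := by rw [Real.rpow_neg hε.le, ← Real.inv_rpow hε.le]; ring

theorem stwt_iff_tendsto (hα : 1 < α) (hγ : ∀ j, 0 < γ j) (hγM : ∀ j, γ j ≤ M)
    (hσ : 0 < σ) (hτ : 0 < τ) :
    STWT c α γ σ τ ↔
      Tendsto (fun s : ℕ => (1 / (s : ℝ) ^ σ) * ∑ j ∈ Finset.range s, γ j) atTop (𝓝 0) := by
  simp only [one_div_mul_eq_div]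
  rw [tendsto_div_zero_iff_forall_exists_le (g := fun s : ℕ => (s : ℝ) ^ σ)
    (Eventually.of_forall fun s => Finset.sum_nonneg fun j _ => (hγ j).le)
    ((tendsto_rpow_atTop hσ).comp tendsto_natCast_atTop_atTop)]
  exact ⟨forall_exists_sum_le_of_stwt hα hγ hγM hσ hτ,
    stwt_of_forall_exists_sum_le hα hγ hγM hσ hτ⟩

theorem wt_iff_stwt_one_one : WT c α γ ↔ STWT c α γ 1 1 := by
  simp only [WT, STWT, Real.rpow_one, Real.rpow_neg_one]

theorem wt_iff_tendsto (hα : 1 < α) (hγ : ∀ j, 0 < γ j) (hγM : ∀ j, γ j ≤ M) :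
    WT c α γ ↔
      Tendsto (fun s : ℕ => (1 / (s : ℝ)) * ∑ j ∈ Finset.range s, γ j) atTop (𝓝 0) := by
  simpa only [Real.rpow_one] using
    wt_iff_stwt_one_one.trans (stwt_iff_tendsto hα hγ hγM one_pos one_pos)

theorem uwt_iff_tendsto (hα : 1 < α) (hγ : ∀ j, 0 < γ j) (hγM : ∀ j, γ j ≤ M) :
    UWT c α γ ↔ ∀ σ : ℝ, 0 < σ → σ ≤ 1 →
      Tendsto (fun s : ℕ => (1 / (s : ℝ) ^ σ) * ∑ j ∈ Finset.range s, γ j) atTop (𝓝 0) :=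
  ⟨fun h σ hσ hσ1 =>
    (stwt_iff_tendsto hα hγ hγM hσ one_pos).1 (h σ 1 hσ hσ1 one_pos le_rfl),
  fun h σ _ hσ hσ1 hτ _ => (stwt_iff_tendsto hα hγ hγM hσ hτ).2 (h σ hσ hσ1)⟩

end Tractability

end AnchoredSpace

end

theorem mainTheorem11_general {α : ℕ} (hα : 1 < α) {γ : ℕ → ℝ} (hγ_pos : ∀ j, 0 < γ j) {M : ℝ}
    (hγ_le : ∀ j, γ j ≤ M) (c : AnchoredSpace.ErrorCriterion) :
    (AnchoredSpace.SPT c α γ ↔ Summable γ) ∧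
    (AnchoredSpace.PT c α γ ↔
      limsup (fun s : ℕ => (((1 / Real.log s) * ∑ j ∈ Finset.range s, γ j : ℝ) : EReal)) atTop
        < ⊤) ∧
    (AnchoredSpace.WT c α γ ↔
      Tendsto (fun s : ℕ => (1 / (s : ℝ)) * ∑ j ∈ Finset.range s, γ j) atTop (𝓝 0)) ∧
    (∀ σ τ : ℝ, 0 < σ → 0 < τ →
      (AnchoredSpace.STWT c α γ σ τ ↔
        Tendsto (fun s : ℕ => (1 / (s : ℝ) ^ σ) * ∑ j ∈ Finset.range s, γ j) atTop (𝓝 0))) ∧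
    (AnchoredSpace.UWT c α γ ↔
      ∀ σ : ℝ, 0 < σ → σ ≤ 1 →
        Tendsto (fun s : ℕ => (1 / (s : ℝ) ^ σ) * ∑ j ∈ Finset.range s, γ j) atTop (𝓝 0)) :=
  ⟨AnchoredSpace.spt_iff_summable hα hγ_pos hγ_le,
    AnchoredSpace.pt_iff_limsup_lt_top hα hγ_pos hγ_le,
    AnchoredSpace.wt_iff_tendsto hα hγ_pos hγ_le,
    fun _ _ hσ hτ => AnchoredSpace.stwt_iff_tendsto hα hγ_pos hγ_le hσ hτ,
    AnchoredSpace.uwt_iff_tendsto hα hγ_pos hγ_le⟩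

theorem mainTheorem11 (α : ℕ) (hα : 1 < α) (γ : ℕ → ℝ) (hγ_pos : ∀ j, 0 < γ j)
    (hγ_le : ∀ j, γ j ≤ 1) (hγ_anti : Antitone γ) (c : AnchoredSpace.ErrorCriterion) :
    (AnchoredSpace.SPT c α γ ↔ Summable γ) ∧
    (AnchoredSpace.PT c α γ ↔
      limsup (fun s : ℕ => (((1 / Real.log s) * ∑ j ∈ Finset.range s, γ j : ℝ) : EReal)) atTop
        < ⊤) ∧
    (AnchoredSpace.WT c α γ ↔
      Tendsto (fun s : ℕ => (1 / (s : ℝ)) * ∑ j ∈ Finset.range s, γ j) atTop (𝓝 0)) ∧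
    (∀ σ τ : ℝ, 0 < σ → σ ≤ 1 → 0 < τ →
      (AnchoredSpace.STWT c α γ σ τ ↔
        Tendsto (fun s : ℕ => (1 / (s : ℝ) ^ σ) * ∑ j ∈ Finset.range s, γ j) atTop (𝓝 0))) ∧
    (AnchoredSpace.UWT c α γ ↔
      ∀ σ : ℝ, 0 < σ → σ ≤ 1 →
        Tendsto (fun s : ℕ => (1 / (s : ℝ) ^ σ) * ∑ j ∈ Finset.range s, γ j) atTop (𝓝 0)) := by
  obtain ⟨spt, pt, wt, stwt, uwt⟩ := mainTheorem11_general hα hγ_pos hγ_le c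
  exact ⟨spt, pt, wt, fun σ τ hσ _ hτ => stwt σ τ hσ hτ, uwt⟩
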